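/- An instance of house allocation with lower and upper quotas consists of a finite bipartite graph $G=(A\,\dot\cup\,P,E)$ with $n=|A|$ applicants and $m=|P|$ projects, and quotas $\ell,u\colon P\to\mathbb N$. A matching is a set $M\subseteq E$ in which every applicant is incident to at most one edge and every project $p$ is incident either to no edge or to at least $\ell_p$ and at most $u_p$ edges. Write $M(a)$ for the project of $a$ in $M$, and $M(a)=a$ if $a$ is unmatched. Where preferences are given, each applicant $a$ has a strict linear order $\succ_a$ on $N_a\cup\{a\}$ (with $N_a$ the set of neighbours of $a$) in which $a$ is last, given as a list of the elements of $N_a$ in decreasing order. A matching $M'$ dominates $M$ if $M(a)\succ_a M'(a)$ for no $a\in A$ and $M'(a)\succ_a M(a)$ for some $a\in A$; $M$ is Pareto optimal if no matching dominates it. $M'$ is more popular than $M$ if $|\{a\in A: M'(a)\succ_a M(a)\}|>|\{a\in A: M(a)\succ_a M'(a)\}|$. Consider the following decision problems. - W-HA$_L^U$: given $G,\ell,u$, weights $w\colon E\to\mathbb Q$ and a bound $W\in\mathbb Q$, is there a matching $M$ with $\sum_{e\in M}w(e)\ge W$? - POPV-HA$_L^U$: given $G,\ell,u,(\succ_a)_{a\in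 A}$ and a matching $M$, is there a matching that is more popular than $M$? - POV-HA$_L^U$: given $G,\ell,u,(\succ_a)_{a\in A}$ and a matching $M$, is there a matching that dominates $M$? - PERPO-HA$_L^U$: given $G,\ell,u,(\succ_a)_{a\in A}$, is there a Pareto optimal matching that matches all applicants? Graphs are encoded by adjacency matrices or by the preference lists; quotas, indices of projects, and the numerators and denominators of the weights and of $W$ are encoded in binary; $|\mathcal I|$ denotes the size of the encoding of an instance $\mathcal I$. Theorem. Each of these four problems is fixed-parameter tractable when parameterized by the number $n$ of applicants: for each of them there are an algorithm, a computable function $f\colon\mathbb N\to\mathbb N$ and a constant $c\in\mathbb N$ such that the algorithm decides every instance $\mathcal I$ in at most $f(n)\cdot|\mathcal I|^{c}$ steps. (An algorithm is a WHILE program over binary trees, in which each elementary operation costs one step; up to polynomial overhead this is the same as a Turing machine.) -/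

import Mathlib

namespace HouseAllocation

/-! ### The model of computation: WHILE programs over binary trees, with running times

These are the WHILE programs of N. D. Jones (*Computability and Complexity from a Programming
Perspective*): finitely many variables hold binary trees, an elementary operation (reading a
variable, `nil`, `cons`, `hd`, `tl`, a test, an assignment) costs one step. There is no arithmetic:
numbers are lists of bits. This model and Turing machines simulate each other with polynomial
overhead on decision problems. -/

/-- Binary trees, the data of WHILE programs. -/
inductive Data : Type
  | nil : Data
  | cons : Data → Data → Data

namespace Data

/-- The size of a tree: its number of nodes, leaves included. -/
def size : Data → ℕ
  | nil => 1
  | cons x y => size x + size y + 1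

/-- Left component, with `hd nil = nil`. -/
def hd : Data → Data
  | nil => nil
  | cons x _ => x

/-- Right component, with `tl nil = nil`. -/
def tl : Data → Data
  | nil => nil
  | cons _ y => y

end Data

/-- The values of all variables; a program mentions only finitely many of them. -/
abbrev Store : Type := ℕ → Data

/-- Expressions. -/
inductive Expr : Type
  | var : ℕ → Expr
  | nil : Expr
  | cons : Expr → Expr → Expr
  | hd : Expr → Expr
  | tl : Expr → Expr

namespace Expr

/-- The value of an expression in a store. -/
def eval (s : Store) : Expr → Data
  | var i => s i
  | nil => Data.nil
  | cons e f => Data.cons (eval s e) (eval s f)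
  | hd e => (eval s e).hd
  | tl e => (eval s e).tl

/-- The time for evaluating an expression: the number of its operations. -/
def time : Expr → ℕ
  | var _ => 1
  | nil => 1
  | cons e f => time e + time f + 1
  | hd e => time e + 1
  | tl e => time e + 1

end Expr

/-- Programs. -/
inductive Prog : Type
  | assign : ℕ → Expr → Prog
  | seq : Prog → Prog → Prog
  | ite : Expr → Prog → Prog → Prog
  | loop : Expr → Prog → Prog

/-- `Exec c s s' t`: the program `c`, started in the store `s`, halts in the store `s'` after exactly
`t` steps. The value `nil` counts as false in tests, every other tree as true. -/
inductive Exec : Prog → Store → Store → ℕ → Prop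
  | assign (i : ℕ) (e : Expr) (s : Store) :
      Exec (.assign i e) s (Function.update s i (e.eval s)) (e.time + 1)
  | seq {c d : Prog} {s s' s'' : Store} {t t' : ℕ} (h : Exec c s s' t) (h' : Exec d s' s'' t') :
      Exec (.seq c d) s s'' (t + t' + 1)
  | ite_true {e : Expr} {c d : Prog} {s s' : Store} {t : ℕ} (he : e.eval s ≠ Data.nil)
      (h : Exec c s s' t) : Exec (.ite e c d) s s' (e.time + t + 1)
  | ite_false {e : Expr} {c d : Prog} {s s' : Store} {t : ℕ} (he : e.eval s = Data.nil)
      (h : Exec d s s' t) : Exec (.ite e c d) s s' (e.time + t + 1)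
  | loop_true {e : Expr} {c : Prog} {s s' s'' : Store} {t t' : ℕ} (he : e.eval s ≠ Data.nil)
      (h : Exec c s s' t) (h' : Exec (.loop e c) s' s'' t') :
      Exec (.loop e c) s s'' (e.time + t + t' + 1)
  | loop_false {e : Expr} {c : Prog} {s : Store} (he : e.eval s = Data.nil) :
      Exec (.loop e c) s s (e.time + 1)

/-- The initial store: the input in variable `0`, all other variables are `nil`. -/
def initStore (x : Data) : Store := fun i => if i = 0 then x else Data.nil

/-- A program halts with a unique result after a unique number of steps. -/
theorem Exec.deterministic {c : Prog} {s s₁ s₂ : Store} {t₁ t₂ : ℕ}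
    (h₁ : Exec c s s₁ t₁) (h₂ : Exec c s s₂ t₂) : s₁ = s₂ ∧ t₁ = t₂ := by
  induction h₁ generalizing s₂ t₂ with
  | assign i e s => cases h₂; exact ⟨rfl, rfl⟩
  | seq _ _ ih ih' =>
    cases h₂ with
    | seq k k' =>
      obtain ⟨rfl, rfl⟩ := ih k
      obtain ⟨rfl, rfl⟩ := ih' k'
      exact ⟨rfl, rfl⟩
  | ite_true he _ ih =>
    cases h₂ with
    | ite_true _ k => obtain ⟨rfl, rfl⟩ := ih k; exact ⟨rfl, rfl⟩
    | ite_false he' _ => exact absurd he' he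
  | ite_false he _ ih =>
    cases h₂ with
    | ite_true he' _ => exact absurd he he'
    | ite_false _ k => obtain ⟨rfl, rfl⟩ := ih k; exact ⟨rfl, rfl⟩
  | loop_true he _ _ ih ih' =>
    cases h₂ with
    | loop_true _ k k' =>
      obtain ⟨rfl, rfl⟩ := ih k
      obtain ⟨rfl, rfl⟩ := ih' k'
      exact ⟨rfl, rfl⟩
    | loop_false he' => exact absurd he' he
  | loop_false he =>
    cases h₂ with
    | loop_true he' _ _ => exact absurd he he'
    | loop_false _ => exact ⟨rfl, rfl⟩

/-- Fixed-parameter tractability of the decision problem `yes` on instances of type `ι`, which are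
given to the algorithm by their encodings `enc I`, with parameter `κ I`: one program decides every
instance in time `f (κ I) * |I| ^ c`, with a computable function `f` and a constant `c`. -/
def FixedParameterTractable {ι : Type} (enc : ι → Data) (κ : ι → ℕ) (yes : ι → Prop) : Prop :=
  ∃ (prog : Prog) (f : ℕ → ℕ) (c : ℕ), Computable f ∧
    ∀ I : ι, ∃ (s : Store) (t : ℕ), Exec prog (initStore (enc I)) s t ∧
      t ≤ f (κ I) * (enc I).size ^ c ∧ (s 0 ≠ Data.nil ↔ yes I)

/-! ### Encodings of numbers and lists (all numbers in binary) -/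

namespace Data

/-- Lists as trees. -/
def ofList : List Data → Data
  | [] => nil
  | x :: l => cons x (ofList l)

/-- Bits as trees. -/
def ofBool (b : Bool) : Data := if b then cons nil nil else nil

/-- Binary representation, least significant bit first, no leading zeros. -/
def ofNat (k : ℕ) : Data := ofList (k.bits.map ofBool)

/-- Sign (true for negative) and absolute value. -/
def ofInt (z : ℤ) : Data := cons (ofBool (decide (z < 0))) (ofNat z.natAbs)

/-- Numerator and denominator in lowest terms. -/
def ofRat (q : ℚ) : Data := cons (ofInt q.num) (ofNat q.den)

/-- An optional entry. -/
def ofOption : Option Data → Data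
  | none => nil
  | some x => cons x nil

end Data

/-! ### House allocation with lower and upper quotas -/

/-- A bipartite graph on `n` applicants and `m` projects, with quotas on the projects. -/
structure QuotaGraph where
  n : ℕ
  m : ℕ
  E : Finset (Fin n × Fin m)
  lower : Fin m → ℕ
  upper : Fin m → ℕ

namespace QuotaGraph

variable (G : QuotaGraph)

/-- Assignments of applicants to projects; `none` means that the applicant is unmatched. -/
abbrev Assignment : Type := Fin G.n → Option (Fin G.m)

/-- `M(p)`: the applicants assigned to `p`. -/
def assigned (M : G.Assignment) (p : Fin G.m) : Finset (Fin G.n) :=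
  Finset.univ.filter fun a => M a = some p

/-- Matchings: only edges are used, and each project is closed or respects its quotas. -/
def IsMatching (M : G.Assignment) : Prop :=
  (∀ a p, M a = some p → (a, p) ∈ G.E) ∧
    ∀ p, (G.assigned M p).card = 0 ∨
      (G.lower p ≤ (G.assigned M p).card ∧ (G.assigned M p).card ≤ G.upper p)

end QuotaGraph

/-- Instances of weighted bipartite matching with lower and upper quotas. -/
structure WeightedInstance extends QuotaGraph where
  w : {e : Fin n × Fin m // e ∈ E} → ℚ
  bound : ℚ

namespace WeightedInstance

variable (I : WeightedInstance)

/-- The total weight of the edges in `M`. -/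
def weight (M : I.Assignment) : ℚ :=
  ∑ e : {e : Fin I.n × Fin I.m // e ∈ I.E}, if M e.1.1 = some e.1.2 then I.w e else 0

/-- Is there a matching of weight at least the bound? -/
def IsYes : Prop := ∃ M : I.Assignment, I.IsMatching M ∧ I.bound ≤ I.weight M

/-- The list of applicants (anonymous, so each is a `nil`); for each project its quotas and its row
of the weighted adjacency matrix; the bound. -/
def encode : Data :=
  .cons (.ofList (List.replicate I.n .nil))
    (.cons
      (.ofList (List.ofFn fun p : Fin I.m =>
        .cons (.ofNat (I.lower p)) (.cons (.ofNat (I.upper p))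
          (.ofList (List.ofFn fun a : Fin I.n =>
            .ofOption (if h : (a, p) ∈ I.E then some (.ofRat (I.w ⟨(a, p), h⟩)) else none))))))
      (.ofRat I.bound))

end WeightedInstance

/-- A graph with quotas and with strict preference lists: `pref a` lists the neighbours of `a`, each
once and in decreasing order of preference. -/
structure PrefInstance extends QuotaGraph where
  pref : Fin n → List (Fin m)
  nodup_pref : ∀ a, (pref a).Nodup
  mem_pref : ∀ a p, p ∈ pref a ↔ (a, p) ∈ E

namespace PrefInstance

variable (I : PrefInstance)

/-- `x ≻ₐ y`: the applicant `a` strictly prefers `x` to `y`, where `none` means being unmatched. A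
project is preferred to those after it on the list and to being unmatched. -/
def Prefers (a : Fin I.n) : Option (Fin I.m) → Option (Fin I.m) → Prop
  | some p, some q => [p, q].Sublist (I.pref a)
  | some p, none => p ∈ I.pref a
  | none, _ => False

/-- `M'` dominates `M`. -/
def Dominates (M' M : I.Assignment) : Prop :=
  (¬ ∃ a, I.Prefers a (M a) (M' a)) ∧ ∃ a, I.Prefers a (M' a) (M a)

/-- `M'` is more popular than `M`. -/
def MorePopular (M' M : I.Assignment) : Prop :=
  {a | I.Prefers a (M a) (M' a)}.ncard < {a | I.Prefers a (M' a) (M a)}.ncard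

/-- `M` is a Pareto optimal matching. -/
def ParetoOptimal (M : I.Assignment) : Prop :=
  I.IsMatching M ∧ ¬ ∃ M' : I.Assignment, I.IsMatching M' ∧ I.Dominates M' M

/-- Is there a Pareto optimal matching that matches all applicants? -/
def HasPerfectParetoOptimal : Prop :=
  ∃ M : I.Assignment, I.ParetoOptimal M ∧ ∀ a, M a ≠ none

/-- The quotas of each project and the preference list of each applicant, which also determine the
graph. -/
def encode : Data :=
  .cons
    (.ofList (List.ofFn fun p : Fin I.m => .cons (.ofNat (I.lower p)) (.ofNat (I.upper p))))
    (.ofList (List.ofFn fun a : Fin I.n =>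
      .ofList ((I.pref a).map fun p => .ofNat (p : ℕ))))

end PrefInstance

/-- Instances of the verification problems: additionally, a matching `M` is given. -/
structure VerificationInstance extends PrefInstance where
  M : toQuotaGraph.Assignment
  isMatching : toQuotaGraph.IsMatching M

namespace VerificationInstance

variable (I : VerificationInstance)

/-- Is there a matching that is more popular than `M`? -/
def HasMorePopular : Prop :=
  ∃ M' : I.Assignment, I.IsMatching M' ∧ I.MorePopular M' I.M

/-- Is there a matching that dominates `M`? -/
def HasDominating : Prop :=
  ∃ M' : I.Assignment, I.IsMatching M' ∧ I.Dominates M' I.M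

/-- The graph, quotas and preferences; the project of each applicant in `M`, if any. -/
def encode : Data :=
  .cons I.toPrefInstance.encode
    (.ofList (List.ofFn fun a : Fin I.n =>
      .ofOption ((I.M a).map fun p => .ofNat (p : ℕ))))

end VerificationInstance

end HouseAllocation

/-! The weighted problem is solved by dynamic programming over the projects. For the projects
treated so far, a table holds, for every set `S` of applicants, the largest weight of an assignment
that matches exactly the applicants in `S` and respects the quotas. A further project receives a set
`U` that is empty or of admissible size, so the new optimum for `S` is the maximum over all
splittings of `S` into disjoint sets `S'` and `U`. This recursion is `feasible_succ`;
`Table.Represents.next` shows that the computed tables follow it, and `solve_iff` draws the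
conclusion.

The other problems reduce to the weighted one with the same applicants. Relative to a given
assignment `M`, an edge weighs `c` if it belongs to `M`, `c + 1` or `1` if its applicant improves
(from a project or from being unmatched), and `0` if the applicant gets worse. By `elim_weightOf`
the weight of `M'` is `c * |M|` plus the number of improvements minus `c` times the number of
deteriorations. With bound `c * |M| + 1`, the choice `c = 1` expresses popularity. Domination is
expressed by deleting the edges to worse projects and taking `c = n + 1`, so that one applicant who
becomes unmatched outweighs all gains. A Pareto optimal matching of all applicants exists as soon as
any matching of all applicants does (`hasPerfectParetoOptimal_of_isMatching`), and the latter is a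
weighted question with all weights equal to `1`.

Running times are handled by a calculus of polynomial-time functions (`PT`), closed under
composition, pairing, case distinction and folds with bounded accumulators; `fun_prop` applies the
closure rules. The sizes of the rational weights are controlled by `FracBound`. Only the list of all
sets is exponential, of size `2 ^ n` times a polynomial; hence `ptn_solve`, and
`fixedParameterTractable_of_reduction` turns polynomial-time reductions into fixed-parameter
tractability. -/

namespace HouseAllocation

/-! ### Polynomially bounded functions -/

/-- Polynomial functions with natural coefficients. -/
inductive IsPoly : (ℕ → ℕ) → Prop
  | const (k : ℕ) : IsPoly fun _ => k
  | id : IsPoly fun n => n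
  | add {p q : ℕ → ℕ} : IsPoly p → IsPoly q → IsPoly fun n => p n + q n
  | mul {p q : ℕ → ℕ} : IsPoly p → IsPoly q → IsPoly fun n => p n * q n

namespace IsPoly

theorem comp {p q : ℕ → ℕ} (hp : IsPoly p) (hq : IsPoly q) : IsPoly fun n => p (q n) := by
  induction hp with
  | const k => exact .const k
  | id => exact hq
  | add _ _ h h' => exact h.add h'
  | mul _ _ h h' => exact h.mul h'

theorem mono {p : ℕ → ℕ} (hp : IsPoly p) : Monotone p := by
  induction hp with
  | const k => exact monotone_const
  | id => exact monotone_id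
  | add _ _ h h' => exact fun a b hab => Nat.add_le_add (h hab) (h' hab)
  | mul _ _ h h' => exact fun a b hab => Nat.mul_le_mul (h hab) (h' hab)

/-- Provides the shape of time bound that fixed-parameter tractability demands. The argument `0` is
excluded, as a power may vanish there; sizes of trees are positive. -/
theorem le_pow {p : ℕ → ℕ} (hp : IsPoly p) : ∃ C k, ∀ n, 1 ≤ n → p n ≤ C * n ^ k := by
  induction hp with
  | const k => exact ⟨k, 0, fun n _ => by simp⟩
  | id => exact ⟨1, 1, fun n _ => by simp⟩
  | add _ _ h h' =>
    obtain ⟨C, k, h⟩ := h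
    obtain ⟨C', k', h'⟩ := h'
    refine ⟨C + C', k + k', fun n hn => ?_⟩
    rw [add_mul]
    exact Nat.add_le_add
      ((h n hn).trans (Nat.mul_le_mul_left _ (Nat.pow_le_pow_right hn (Nat.le_add_right _ _))))
      ((h' n hn).trans (Nat.mul_le_mul_left _ (Nat.pow_le_pow_right hn (Nat.le_add_left _ _))))
  | mul _ _ h h' =>
    obtain ⟨C, k, h⟩ := h
    obtain ⟨C', k', h'⟩ := h'
    refine ⟨C * C', k + k', fun n hn => (Nat.mul_le_mul (h n hn) (h' n hn)).trans (le_of_eq ?_)⟩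
    ring

end IsPoly

/-! ### Types whose elements are encoded as trees -/

/-- Types whose elements are encoded as trees. -/
class Enc (α : Type) where
  enc : α → Data

open Enc

instance : Enc Unit := ⟨fun _ => .nil⟩
instance : Enc Bool := ⟨Data.ofBool⟩
instance : Enc ℕ := ⟨Data.ofNat⟩
instance {α β : Type} [Enc α] [Enc β] : Enc (α × β) := ⟨fun x => .cons (enc x.1) (enc x.2)⟩
instance {α : Type} [Enc α] : Enc (List α) := ⟨fun l => .ofList (l.map enc)⟩
instance {α : Type} [Enc α] : Enc (Option α) := ⟨fun o => .ofOption (o.map enc)⟩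

variable {α β γ δ : Type} [Enc α] [Enc β] [Enc γ] [Enc δ]

/-- The size of the encoding of an element. -/
def esize (x : α) : ℕ := (enc x).size

theorem enc_prod (x : α) (y : β) : enc (x, y) = .cons (enc x) (enc y) := rfl
theorem enc_nil : enc ([] : List α) = .nil := rfl
theorem enc_cons (x : α) (l : List α) : enc (x :: l) = .cons (enc x) (enc l) := rfl
theorem enc_none : enc (none : Option α) = .nil := rfl
theorem enc_some (x : α) : enc (some x) = .cons (enc x) .nil := rfl
theorem enc_false : enc false = .nil := rfl
theorem enc_true : enc true = .cons .nil .nil := rfl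

theorem esize_pos (x : α) : 1 ≤ esize x := by
  unfold esize; cases enc x <;> simp [Data.size]

theorem esize_prod (x : α × β) : esize x = esize x.1 + esize x.2 + 1 := rfl
theorem esize_nil : esize ([] : List α) = 1 := rfl
theorem esize_cons (x : α) (l : List α) : esize (x :: l) = esize x + esize l + 1 := rfl
theorem esize_none : esize (none : Option α) = 1 := rfl
theorem esize_some (x : α) : esize (some x) = esize x + 2 := rfl
theorem esize_nat (k : ℕ) : esize k = esize k.bits := rfl
theorem esize_bool_le (b : Bool) : esize b ≤ 3 := by
  cases b <;> simp [esize, enc, Data.ofBool, Data.size]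

theorem esize_list (l : List α) : esize l = (l.map fun a => esize a + 1).sum + 1 := by
  induction l with
  | nil => rfl
  | cons a l ih => rw [esize_cons, ih, List.map_cons, List.sum_cons]; omega

theorem length_le_esize (l : List α) : l.length ≤ esize l := by
  induction l with
  | nil => simp
  | cons a l ih => rw [esize_cons, List.length_cons]; omega

theorem esize_le_of_mem {a : α} {l : List α} (h : a ∈ l) : esize a ≤ esize l := by
  induction l with
  | nil => simp at h
  | cons b l ih =>
    rw [esize_cons]
    rcases List.mem_cons.1 h with rfl | h
    · omega
    · have := ih h; omega

theorem esize_le_of_sublist {l l' : List α} (h : l'.Sublist l) : esize l' ≤ esize l := by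
  induction h with
  | slnil => rfl
  | cons a _ ih => rw [esize_cons]; omega
  | cons_cons a _ ih => rw [esize_cons, esize_cons]; omega

theorem esize_reverse (l : List α) : esize l.reverse = esize l := by
  rw [esize_list, esize_list, List.map_reverse, List.sum_reverse]

theorem esize_append (l l' : List α) : esize (l ++ l') + 1 = esize l + esize l' := by
  rw [esize_list, esize_list, esize_list, List.map_append, List.sum_append]; omega

theorem esize_list_le {l : List α} {k B : ℕ} (hl : l.length ≤ k) (hB : ∀ a ∈ l, esize a ≤ B) :
    esize l ≤ k * (B + 1) + 1 := by
  rw [esize_list]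
  have h : (l.map fun a => esize a + 1).sum ≤ (l.map fun a => esize a + 1).length * (B + 1) := by
    apply List.sum_le_card_nsmul
    simp only [List.mem_map]
    rintro _ ⟨a, ha, rfl⟩
    exact Nat.add_le_add_right (hB a ha) 1
  rw [List.length_map] at h
  exact Nat.add_le_add_right (h.trans (Nat.mul_le_mul_right _ hl)) 1

/-! ### Programs that use variable `0` as a stack -/

/-- `P` turns the value `d` of variable `0` into `d'` in `t` steps and changes nothing else. -/
def RunsTo (P : Prog) (d d' : Data) (t : ℕ) : Prop :=
  ∀ s : Store, s 0 = d → Exec P s (Function.update s 0 d') t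

theorem RunsTo.seq {P Q : Prog} {d d' d'' : Data} {t t' : ℕ} (h : RunsTo P d d' t)
    (h' : RunsTo Q d' d'' t') : RunsTo (.seq P Q) d d'' (t + t' + 1) := fun s hs => by
  have := h' (Function.update s 0 d') (by simp)
  rw [Function.update_idem] at this
  exact .seq (h s hs) this

theorem RunsTo.assign {e : Expr} {d d' : Data} (h : ∀ s : Store, s 0 = d → e.eval s = d') :
    RunsTo (.assign 0 e) d d' (e.time + 1) := fun s hs => by
  rw [← h s hs]; exact .assign 0 e s

theorem RunsTo.ite_true {e : Expr} {P Q : Prog} {d d' : Data} {t : ℕ}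
    (he : ∀ s : Store, s 0 = d → e.eval s ≠ .nil) (h : RunsTo P d d' t) :
    RunsTo (.ite e P Q) d d' (e.time + t + 1) := fun s hs => .ite_true (he s hs) (h s hs)

theorem RunsTo.ite_false {e : Expr} {P Q : Prog} {d d' : Data} {t : ℕ}
    (he : ∀ s : Store, s 0 = d → e.eval s = .nil) (h : RunsTo Q d d' t) :
    RunsTo (.ite e P Q) d d' (e.time + t + 1) := fun s hs => .ite_false (he s hs) (h s hs)

theorem RunsTo.loop_true {e : Expr} {P : Prog} {d d' d'' : Data} {t t' : ℕ}
    (he : ∀ s : Store, s 0 = d → e.eval s ≠ .nil) (h : RunsTo P d d' t)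
    (h' : RunsTo (.loop e P) d' d'' t') :
    RunsTo (.loop e P) d d'' (e.time + t + t' + 1) := fun s hs => by
  have := h' (Function.update s 0 d') (by simp)
  rw [Function.update_idem] at this
  exact .loop_true (he s hs) (h s hs) this

theorem RunsTo.loop_false {e : Expr} {P : Prog} {d : Data}
    (he : ∀ s : Store, s 0 = d → e.eval s = .nil) :
    RunsTo (.loop e P) d d (e.time + 1) := fun s hs => by
  have : Function.update s 0 d = s := by rw [← hs, Function.update_eq_self]
  rw [this]; exact .loop_false (he s hs)

/-- `f` is computed on top of the stack by a program whose running time, and the size of whose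
result, are polynomial in `N`. -/
def PTN (N : α → ℕ) (f : α → β) : Prop :=
  ∃ (P : Prog) (p : ℕ → ℕ), IsPoly p ∧ ∀ x, esize (f x) ≤ p (N x) ∧
    ∀ r, ∃ t ≤ p (N x), RunsTo P (.cons (enc x) r) (.cons (enc (f x)) r) t

/-- `f` is computable in time polynomial in the size of the argument. -/
@[fun_prop]
def PT (f : α → β) : Prop := PTN esize f

theorem PT.congr {f g : α → β} (hf : PT f) (h : ∀ x, g x = f x) : PT g :=
  (funext h : g = f) ▸ hf

theorem PTN.comp {N : α → ℕ} {g : β → γ} {f : α → β} (hg : PT g) (hf : PTN N f) :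
    PTN N fun x => g (f x) := by
  obtain ⟨P, p, hp, hP⟩ := hf
  obtain ⟨Q, q, hq, hQ⟩ := hg
  refine ⟨.seq P Q, fun n => p n + q (p n) + 1, (hp.add (hq.comp hp)).add (.const 1),
    fun x => ⟨?_, fun r => ?_⟩⟩
  · have := (hQ (f x)).1.trans (hq.mono (hP x).1)
    dsimp only
    omega
  · obtain ⟨t, ht, h⟩ := (hP x).2 r
    obtain ⟨t', ht', h'⟩ := (hQ (f x)).2 r
    have := ht'.trans (hq.mono (hP x).1)
    exact ⟨_, by dsimp only; omega, h.seq h'⟩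

/-- The base case: evaluating one expression takes time independent of the input, so only the size
of the result has to be bounded. -/
theorem PTN.of_expr {N : α → ℕ} {f : α → β} {p : ℕ → ℕ} (hp : IsPoly p)
    (hs : ∀ x, esize (f x) ≤ p (N x)) (e : Expr)
    (he : ∀ (x : α) (r : Data) (s : Store), s 0 = .cons (enc x) r → e.eval s = enc (f x)) :
    PTN N f := by
  refine ⟨.assign 0 (.cons e (.tl (.var 0))), fun n => p n + (e.time + 4),
    hp.add (.const _), fun x => ⟨(hs x).trans (Nat.le_add_right _ _), fun r => ?_⟩⟩
  refine ⟨_, ?_, RunsTo.assign fun s hs => ?_⟩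
  · simp only [Expr.time]; omega
  · simp only [Expr.eval, he x r s hs, hs, Data.tl]

/-- The stack serves as memory: the input is duplicated, `f` is applied to the upper copy, its value
is exchanged with the lower copy, and `g` is applied to that. -/
theorem PTN.prodMk {N : α → ℕ} {f : α → β} {g : α → γ} (hf : PTN N f) (hg : PTN N g) :
    PTN N fun x => (f x, g x) := by
  obtain ⟨P, p, hp, hP⟩ := hf
  obtain ⟨Q, q, hq, hQ⟩ := hg
  let v : Expr := .var 0
  let e₁ : Expr := .cons (.hd v) v
  let e₂ : Expr := .cons (.hd (.tl v)) (.cons (.hd v) (.tl (.tl v)))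
  let e₃ : Expr := .cons (.cons (.hd (.tl v)) (.hd v)) (.tl (.tl v))
  refine ⟨.seq (.seq (.seq (.seq (.assign 0 e₁) P) (.assign 0 e₂)) Q) (.assign 0 e₃),
    fun n => p n + q n + (e₁.time + e₂.time + e₃.time + 7), (hp.add hq).add (.const _),
    fun x => ⟨?_, fun r => ?_⟩⟩
  · have := (hP x).1
    have := (hQ x).1
    rw [esize_prod]; dsimp only; omega
  · obtain ⟨t, ht, h⟩ := (hP x).2 (.cons (enc x) r)
    obtain ⟨t', ht', h'⟩ := (hQ x).2 (.cons (enc (f x)) r)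
    refine ⟨_, ?_, (((RunsTo.assign fun s hs => ?_).seq h).seq
      (RunsTo.assign fun s hs => ?_)).seq h' |>.seq (RunsTo.assign fun s hs => ?_)⟩
    · dsimp only; omega
    · simp [e₁, v, Expr.eval, hs, Data.hd]
    · simp [e₂, v, Expr.eval, hs, Data.hd, Data.tl]
    · simp [e₃, v, Expr.eval, hs, Data.hd, Data.tl, enc_prod]

/-- A case distinction on whether the value of `c` is encoded by `nil`. -/
theorem PTN.ite_nil {N : α → ℕ} {c : α → β} {f : α → δ} (hc : PTN N c) (h : α → γ)
    {g : γ → δ} (hg : PT g) (e : Expr) {p : ℕ → ℕ} (hp : IsPoly p)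
    (hs : ∀ x, enc (c x) ≠ .nil → esize (h x) ≤ p (N x))
    (he : ∀ x, enc (c x) ≠ .nil → ∀ (r : Data) (s : Store),
      s 0 = .cons (enc (c x)) (.cons (enc x) r) → e.eval s = enc (h x))
    (h₁ : ∀ x, enc (c x) ≠ .nil → f x = g (h x)) {f' : α → δ} (hf : PTN N f')
    (h₂ : ∀ x, enc (c x) = .nil → f x = f' x) : PTN N f := by
  obtain ⟨P, p₁, hp₁, hP⟩ := hc
  obtain ⟨Q, p₂, hp₂, hQ⟩ := hg
  obtain ⟨R, p₃, hp₃, hR⟩ := hf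
  let v : Expr := .var 0
  let e₁ : Expr := .cons (.hd v) v
  let e₂ : Expr := .cons e (.tl (.tl v))
  let e₃ : Expr := .tl v
  refine ⟨.seq (.seq (.assign 0 e₁) P)
      (.ite (.hd v) (.seq (.assign 0 e₂) Q) (.seq (.assign 0 e₃) R)),
    fun n => p₁ n + p₂ (p n) + p₃ n + (e₁.time + e₂.time + e₃.time + 10),
    ((hp₁.add (hp₂.comp hp)).add hp₃).add (.const _), fun x => ?_⟩
  have hP' := hP x
  have hR' := hR x
  by_cases hn : enc (c x) = .nil
  · rw [h₂ x hn]
    refine ⟨hR'.1.trans (by dsimp only; omega), fun r => ?_⟩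
    obtain ⟨t, ht, k⟩ := hP'.2 (.cons (enc x) r)
    obtain ⟨t', ht', k'⟩ := hR'.2 r
    refine ⟨_, ?_, ((RunsTo.assign fun s hs => ?_).seq k).seq (RunsTo.ite_false (fun s hs => ?_)
      ((RunsTo.assign fun s hs => ?_).seq k'))⟩
    · simp only [Expr.time, v]; omega
    · simp [e₁, v, Expr.eval, hs, Data.hd]
    · simp [v, Expr.eval, hs, Data.hd, hn]
    · simp [e₃, v, Expr.eval, hs, Data.tl]
  · rw [h₁ x hn]
    have hQ' := hQ (h x)
    have hm := hp₂.mono (hs x hn)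
    have := hQ'.1
    refine ⟨by dsimp only; omega, fun r => ?_⟩
    obtain ⟨t, ht, k⟩ := hP'.2 (.cons (enc x) r)
    obtain ⟨t', ht', k'⟩ := hQ'.2 r
    refine ⟨_, ?_, ((RunsTo.assign fun s hs => ?_).seq k).seq (RunsTo.ite_true (fun s hs => ?_)
      ((RunsTo.assign fun s hs => ?_).seq k'))⟩
    · simp only [Expr.time, v]; omega
    · simp [e₁, v, Expr.eval, hs, Data.hd]
    · simp [v, Expr.eval, hs, Data.hd, hn]
    · simp [e₂, v, Expr.eval, he x hn r s hs, hs, Data.tl]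

/-! ### Iteration over lists -/

/-- The accumulators for all prefixes must be bounded in advance, since a polynomial bound for a
single step does not survive iteration. -/
theorem PTN.foldl {N : α → ℕ} {l : α → List β} {b : α → γ} {step : α → γ → β → γ}
    (hl : PTN N l) (hb : PTN N b) (hstep : PT fun q : (α × γ) × β => step q.1.1 q.1.2 q.2)
    {p : ℕ → ℕ} (hp : IsPoly p) (hN : ∀ x, esize x ≤ p (N x))
    (hs : ∀ x l', l' <+: l x → esize (l'.foldl (step x) (b x)) ≤ p (N x)) :
    PTN N fun x => (l x).foldl (step x) (b x) := by
  obtain ⟨pl, hpl, hpl'⟩ : ∃ p, IsPoly p ∧ ∀ x, esize (l x) ≤ p (N x) := by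
    obtain ⟨P, p, hp, h⟩ := hl
    exact ⟨p, hp, fun x => (h x).1⟩
  obtain ⟨pb, hpb, hpb'⟩ : ∃ p, IsPoly p ∧ ∀ x, esize (b x) ≤ p (N x) := by
    obtain ⟨P, p, hp, h⟩ := hb
    exact ⟨p, hp, fun x => (h x).1⟩
  have hid : PTN N fun x : α => x := by
    refine .of_expr hp hN (.hd (.var 0)) fun x r s h => ?_
    simp [Expr.eval, h, Data.hd]
  obtain ⟨P, p₁, hp₁, hP⟩ := hl.prodMk (hid.prodMk hb)
  obtain ⟨Q, q, hq, hQ⟩ := hstep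
  let v : Expr := .var 0
  let e₁ : Expr := .cons (.cons (.cons (.hd (.tl (.hd v))) (.tl (.tl (.hd v))))
    (.hd (.hd (.hd v)))) v
  let e₂ : Expr := .cons (.cons (.tl (.hd (.hd (.tl v)))) (.cons (.hd (.tl (.hd (.tl v)))) (.hd v)))
    (.tl (.tl v))
  let e₃ : Expr := .cons (.tl (.tl (.hd v))) (.tl v)
  let c : ℕ := e₁.time + e₂.time + e₃.time + 20
  -- The loop keeps the rest of the list, the parameter `x` and the accumulator on top of the stack.
  -- The bound `A` for the list stays fixed in the induction, which gives every round the same time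
  -- bound.
  have key : ∀ (x : α) (A : ℕ) (r : Data) (l : List β) (acc : γ), esize l ≤ A →
      (∀ l', l' <+: l → esize (l'.foldl (step x) acc) ≤ p (N x)) →
      ∃ t ≤ l.length * (q (p (N x) + p (N x) + A + 2) + c) + c,
        RunsTo (.loop (.hd (.hd v)) (.seq (.seq (.assign 0 e₁) Q) (.assign 0 e₂)))
          (.cons (.cons (enc l) (.cons (enc x) (enc acc))) r)
          (.cons (.cons .nil (.cons (enc x) (enc (l.foldl (step x) acc)))) r) t := by
    intro x A r l
    induction l with
    | nil =>
      intro acc _ _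
      refine ⟨_, ?_, RunsTo.loop_false fun s hs => ?_⟩
      · simp [Expr.time, v, c]
      · simp [Expr.eval, v, hs, Data.hd, enc_nil]
    | cons a l ih =>
      intro acc hA hacc
      have hA' := hA
      rw [esize_cons] at hA'
      obtain ⟨t, ht, k⟩ := ih (step x acc a) (by omega) fun l' hl' => by
        have := hacc (a :: l') ((List.prefix_cons_inj a).2 hl')
        rwa [List.foldl_cons] at this
      obtain ⟨t', ht', k'⟩ := (hQ ((x, acc), a)).2
        (.cons (.cons (enc (a :: l)) (.cons (enc x) (enc acc))) r)
      have hsz : esize ((x, acc), a) ≤ p (N x) + p (N x) + A + 2 := by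
        have := hacc [] (List.nil_prefix)
        have := hN x
        simp only [esize_prod, List.foldl_nil] at *
        omega
      have hm := hq.mono hsz
      refine ⟨_, ?_, RunsTo.loop_true (fun s hs => ?_)
        (((RunsTo.assign fun s hs => ?_).seq k').seq (RunsTo.assign fun s hs => ?_)) k⟩
      · have h2 : (Expr.hd (.hd v)).time = 3 := rfl
        rw [h2, List.length_cons, Nat.succ_mul]
        have : c = e₁.time + e₂.time + e₃.time + 20 := rfl
        omega
      · simp [Expr.eval, v, hs, Data.hd, enc_cons]
      · simp [e₁, Expr.eval, v, hs, Data.hd, Data.tl, enc_cons, enc_prod]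
      · simp [e₂, Expr.eval, v, hs, Data.hd, Data.tl, enc_cons]
  refine ⟨.seq (.seq P (.loop (.hd (.hd v)) (.seq (.seq (.assign 0 e₁) Q) (.assign 0 e₂))))
      (.assign 0 e₃),
    fun n => p n + p₁ n + pl n * (q (p n + p n + pl n + 2) + c) + (2 * c),
    ((hp.add hp₁).add (hpl.mul ((hq.comp (((hp.add hp).add hpl).add (.const 2))).add
      (.const c)))).add (.const _), fun x => ⟨?_, fun r => ?_⟩⟩
  · have := hs x (l x) (List.prefix_refl _)
    dsimp only
    omega
  · obtain ⟨t, ht, k⟩ := (hP x).2 r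
    obtain ⟨t', ht', k'⟩ := key x (pl (N x)) r (l x) (b x) (hpl' x) (hs x)
    refine ⟨_, ?_, (k.seq k').seq (RunsTo.assign fun s hs => ?_)⟩
    · have : c = e₁.time + e₂.time + e₃.time + 20 := rfl
      have := Nat.mul_le_mul_right (q (p (N x) + p (N x) + pl (N x) + 2) + c)
        ((length_le_esize (l x)).trans (hpl' x))
      dsimp only
      omega
    · simp [e₃, Expr.eval, v, hs, Data.hd, Data.tl]

/-! ### Functions computable in polynomial time -/

namespace PT

@[fun_prop]
theorem id : PT fun x : α => x :=
  PTN.of_expr .id (fun _ => le_rfl) (.hd (.var 0)) fun x r s h => by simp [Expr.eval, h, Data.hd]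

@[fun_prop]
theorem comp {g : β → γ} {f : α → β} (hg : PT g) (hf : PT f) : PT fun x => g (f x) :=
  PTN.comp hg hf

/-- An expression whose value is a given tree. -/
def constExpr : Data → Expr
  | .nil => .nil
  | .cons x y => .cons (constExpr x) (constExpr y)

theorem eval_constExpr (d : Data) (s : Store) : (constExpr d).eval s = d := by
  induction d with
  | nil => rfl
  | cons x y hx hy => simp [constExpr, Expr.eval, hx, hy]

@[fun_prop]
theorem const (y : β) : PT fun _ : α => y :=
  PTN.of_expr (.const (esize y)) (fun _ => le_rfl) (constExpr (enc y))
    fun _ _ _ _ => eval_constExpr _ _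

@[fun_prop]
theorem prodMk {f : α → β} {g : α → γ} (hf : PT f) (hg : PT g) : PT fun x => (f x, g x) :=
  PTN.prodMk hf hg

@[fun_prop]
theorem fst : PT fun x : α × β => x.1 :=
  PTN.of_expr .id (fun x => by rw [esize_prod]; omega) (.hd (.hd (.var 0))) fun x r s h => by
    simp [Expr.eval, h, Data.hd, enc]

@[fun_prop]
theorem snd : PT fun x : α × β => x.2 :=
  PTN.of_expr .id (fun x => by rw [esize_prod]; omega) (.tl (.hd (.var 0))) fun x r s h => by
    simp [Expr.eval, h, Data.hd, Data.tl, enc]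

@[fun_prop]
theorem cons {f : α → β} {l : α → List β} (hf : PT f) (hl : PT l) : PT fun x => f x :: l x := by
  refine comp (g := fun q : β × List β => q.1 :: q.2) ?_ (hf.prodMk hl)
  exact PTN.of_expr .id (fun _ => le_rfl) (.hd (.var 0)) fun x r s h => by
    simp [Expr.eval, h, Data.hd, enc_cons, ← enc_prod]

@[fun_prop]
theorem some {f : α → β} (hf : PT f) : PT fun x => some (f x) := by
  refine comp (g := fun y : β => Option.some y) ?_ hf
  exact PTN.of_expr (.add .id (.const 2)) (fun _ => le_rfl) (.cons (.hd (.var 0)) .nil)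
    fun x r s h => by simp [Expr.eval, h, Data.hd, enc_some]

@[fun_prop]
theorem cond {c : α → Bool} {f g : α → β} (hc : PT c) (hf : PT f) (hg : PT g) :
    PT fun x => bif c x then f x else g x := by
  refine PTN.ite_nil hc (fun x => x) hf (.hd (.tl (.var 0))) .id (fun _ _ => le_rfl)
    (fun x _ r s h => by simp [Expr.eval, h, Data.hd, Data.tl]) (fun x hx => ?_) hg fun x hx => ?_
  · cases h : c x
    · rw [h] at hx; exact absurd rfl hx
    · rfl
  · cases h : c x
    · rfl
    · rw [h] at hx; cases hx

@[fun_prop]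
theorem optionElim {o : α → Option β} {f : α → γ} {g : α → β → γ} (ho : PT o) (hf : PT f)
    (hg : PT fun q : α × β => g q.1 q.2) : PT fun x => (o x).elim (f x) (g x) := by
  have ho' := ho
  obtain ⟨P, p, hp, hP⟩ := ho'
  -- The branch data in `PTN.ite_nil` form a total function, which needs a default element of `β`;
  -- its value never matters. If `β` is empty, the option is always `none`.
  by_cases hβ : Nonempty β
  · have := hβ.some
    refine PTN.ite_nil ho (fun x => (x, (o x).getD this)) hg
      (.cons (.hd (.tl (.var 0))) (.hd (.hd (.var 0)))) ((IsPoly.id.add hp).add (.const 1))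
      (fun x hx => ?_) (fun x hx r s h => ?_) (fun x hx => ?_) hf fun x hx => ?_
    · have := (hP x).1
      cases h : o x
      · rw [h] at hx; exact absurd rfl hx
      · rw [h, esize_some] at this
        simp only [esize_prod, Option.getD_some]; omega
    · cases h' : o x
      · rw [h'] at hx; exact absurd rfl hx
      · simp [Expr.eval, h, Data.hd, Data.tl, h', enc_some, enc_prod]
    · cases h' : o x
      · rw [h'] at hx; exact absurd rfl hx
      · rfl
    · cases h' : o x
      · rfl
      · rw [h'] at hx; cases hx
  · refine congr hf fun x => ?_
    cases h : o x with
    | none => rfl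
    | some y => exact absurd ⟨y⟩ hβ

@[fun_prop]
theorem listElim {l : α → List β} {f : α → γ} {g : α → β → List β → γ} (hl : PT l) (hf : PT f)
    (hg : PT fun q : α × (β × List β) => g q.1 q.2.1 q.2.2) :
    PT fun x => (l x).casesOn (motive := fun _ => γ) (f x) (g x) := by
  have hl' := hl
  obtain ⟨P, p, hp, hP⟩ := hl'
  by_cases hβ : Nonempty β
  · have y := hβ.some
    refine PTN.ite_nil hl (fun x => (x, ((l x).head?.getD y, (l x).tail))) hg
      (.cons (.hd (.tl (.var 0))) (.hd (.var 0))) ((IsPoly.id.add hp).add (.const 1))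
      (fun x hx => ?_) (fun x hx r s h => ?_) (fun x hx => ?_) hf fun x hx => ?_
    · have := (hP x).1
      cases h : l x
      · rw [h] at hx; exact absurd rfl hx
      · rw [h, esize_cons] at this
        simp only [esize_prod, List.head?_cons, Option.getD_some, List.tail_cons]; omega
    · cases h' : l x
      · rw [h'] at hx; exact absurd rfl hx
      · simp [Expr.eval, h, Data.hd, Data.tl, h', enc_cons, enc_prod]
    · cases h' : l x
      · rw [h'] at hx; exact absurd rfl hx
      · rfl
    · cases h' : l x
      · rfl
      · rw [h'] at hx; cases hx
  · refine congr hf fun x => ?_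
    cases h : l x with
    | nil => rfl
    | cons y _ => exact absurd ⟨y⟩ hβ

theorem foldl {l : α → List β} {b : α → γ} {step : α → γ → β → γ}
    (hl : PT l) (hb : PT b) (hstep : PT fun q : (α × γ) × β => step q.1.1 q.1.2 q.2)
    {p : ℕ → ℕ} (hp : IsPoly p)
    (hs : ∀ x l', l' <+: l x → esize (l'.foldl (step x) (b x)) ≤ p (esize x)) :
    PT fun x => (l x).foldl (step x) (b x) :=
  PTN.foldl hl hb hstep (hp.add .id) (fun _ => Nat.le_add_left _ _)
    fun x l' hl' => (hs x l' hl').trans (Nat.le_add_right _ _)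

end PT

/-! ### Lists, options and Booleans in polynomial time -/

namespace PT

/-- Programs see only encodings, so one program computes both functions. This identifies a number
with its list of bits. -/
theorem of_enc_eq {f : α → β} {g : α → γ} (hf : PT f) (h : ∀ x, enc (g x) = enc (f x)) : PT g := by
  obtain ⟨P, p, hp, hP⟩ := hf
  refine ⟨P, p, hp, fun x => ?_⟩
  have := hP x
  rw [esize, h x]
  exact this

theorem exists_esize_le {f : α → β} (hf : PT f) :
    ∃ p, IsPoly p ∧ ∀ x, esize (f x) ≤ p (esize x) := by
  obtain ⟨P, p, hp, hP⟩ := hf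
  exact ⟨p, hp, fun x => (hP x).1⟩

theorem foldl_of_bounded {l : α → List β} {b : α → γ} {step : α → γ → β → γ}
    (hl : PT l) (hb : PT b) (hstep : PT fun q : (α × γ) × β => step q.1.1 q.1.2 q.2)
    (C : ℕ) (hC : ∀ y : γ, esize y ≤ C) : PT fun x => (l x).foldl (step x) (b x) :=
  foldl hl hb hstep (.const C) fun _ _ _ => hC _

theorem foldl_cons_eq {α β : Type*} (f : α → β) (l : List α) (b : List β) :
    l.foldl (fun acc a => f a :: acc) b = (l.map f).reverse ++ b := by
  induction l generalizing b with
  | nil => rfl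
  | cons a l ih => simp [ih]

@[fun_prop]
theorem reverse {l : α → List β} (hl : PT l) : PT fun x => (l x).reverse := by
  refine comp (g := fun l : List β => l.reverse) ?_ hl
  refine congr (f := fun l : List β => l.foldl (fun acc a => a :: acc) []) ?_ fun l => ?_
  · refine foldl id (const _) (by fun_prop) .id fun l l' h => ?_
    rw [foldl_cons_eq (fun a => a), List.append_nil, List.map_id', esize_reverse]
    exact esize_le_of_sublist h.sublist
  · rw [foldl_cons_eq fun a => a]; simp

@[fun_prop]
theorem append {l l' : α → List β} (hl : PT l) (hl' : PT l') : PT fun x => l x ++ l' x := by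
  refine congr (f := fun x => ((l x).reverse).foldl (fun acc a => a :: acc) (l' x)) ?_ fun x => ?_
  · obtain ⟨p, hp, h⟩ := (reverse hl).exists_esize_le
    obtain ⟨p', hp', h'⟩ := hl'.exists_esize_le
    refine foldl (reverse hl) hl' (by fun_prop) (hp.add hp') fun x s hs => ?_
    rw [foldl_cons_eq (fun a => a), List.map_id']
    have h1 := esize_append s.reverse (l' x)
    rw [esize_reverse] at h1
    have h2 := esize_le_of_sublist hs.sublist
    have := h x
    have := h' x
    omega
  · rw [foldl_cons_eq fun a => a]; simp

@[fun_prop]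
theorem map {l : α → List β} {f : α → β → γ} (hl : PT l) (hf : PT fun q : α × β => f q.1 q.2) :
    PT fun x => (l x).map (f x) := by
  refine congr (f := fun x => ((l x).foldl (fun acc b => f x b :: acc) []).reverse) ?_ fun x => ?_
  · obtain ⟨p, hp, h⟩ := hf.exists_esize_le
    obtain ⟨p', hp', h'⟩ := hl.exists_esize_le
    refine reverse (foldl hl (const _) ?_
      ((hp'.mul ((hp.comp ((IsPoly.id.add hp').add (.const 1))).add (.const 1))).add (.const 1))
      fun x s hs => ?_)
    · exact cons (hf.comp (f := fun q : (α × List γ) × β => (q.1.1, q.2)) (by fun_prop))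
        (by fun_prop)
    · rw [foldl_cons_eq, List.append_nil, esize_reverse]
      refine esize_list_le ?_ fun c hc => ?_
      · rw [List.length_map]
        exact hs.length_le.trans ((length_le_esize _).trans (h' x))
      · obtain ⟨b, hb, rfl⟩ := List.mem_map.1 hc
        refine (h (x, b)).trans (hp.mono ?_)
        have := (esize_le_of_mem (hs.subset hb)).trans (h' x)
        simp only [esize_prod]; omega
  · rw [foldl_cons_eq]; simp

@[fun_prop]
theorem flatten {l : α → List (List β)} (hl : PT l) : PT fun x => (l x).flatten := by
  have key : ∀ (l : List (List β)) b, l.foldl (fun acc a => acc ++ a) b = b ++ l.flatten := by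
    intro l
    induction l with
    | nil => simp
    | cons a l ih => simp [ih]
  have hsz : ∀ l : List (List β), esize l.flatten ≤ esize l := by
    intro l
    induction l with
    | nil => exact le_rfl
    | cons a l ih =>
      have := esize_append a l.flatten
      rw [List.flatten_cons, esize_cons]; omega
  refine comp (g := fun l : List (List β) => l.flatten) ?_ hl
  refine congr (f := fun l : List (List β) => l.foldl (fun acc a => acc ++ a) []) ?_ fun l => ?_
  · refine foldl id (const _) (by fun_prop) .id fun l l' h => ?_
    rw [key, List.nil_append]
    exact (hsz _).trans (esize_le_of_sublist h.sublist)
  · rw [key]; simp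

@[fun_prop]
theorem flatMap {l : α → List β} {f : α → β → List γ} (hl : PT l)
    (hf : PT fun q : α × β => f q.1 q.2) : PT fun x => (l x).flatMap (f x) := by
  refine congr (f := fun x => ((l x).map (f x)).flatten) (by fun_prop) fun x => ?_
  rw [List.flatMap_def]

@[fun_prop]
theorem filterMap {l : α → List β} {f : α → β → Option γ} (hl : PT l)
    (hf : PT fun q : α × β => f q.1 q.2) : PT fun x => (l x).filterMap (f x) := by
  refine congr (f := fun x => (l x).flatMap fun y => (f x y).elim [] fun z => [z])
    (by fun_prop) fun x => ?_
  rw [List.filterMap_eq_flatMap_toList]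
  congr 1; funext y; cases f x y <;> rfl

@[fun_prop]
theorem and {f g : α → Bool} (hf : PT f) (hg : PT g) : PT fun x => f x && g x :=
  congr (hf.cond hg (const false)) fun x => by cases f x <;> rfl

@[fun_prop]
theorem or {f g : α → Bool} (hf : PT f) (hg : PT g) : PT fun x => f x || g x :=
  congr (hf.cond (const true) hg) fun x => by cases f x <;> rfl

@[fun_prop]
theorem not {f : α → Bool} (hf : PT f) : PT fun x => !f x :=
  congr (hf.cond (const false) (const true)) fun x => by cases f x <;> rfl

@[fun_prop]
theorem xor {f g : α → Bool} (hf : PT f) (hg : PT g) : PT fun x => f x ^^ g x :=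
  congr (hf.cond (not hg) hg) fun x => by cases f x <;> cases g x <;> rfl

@[fun_prop]
theorem beq {f g : α → Bool} (hf : PT f) (hg : PT g) : PT fun x => f x == g x :=
  congr (hf.cond hg (not hg)) fun x => by cases f x <;> cases g x <;> rfl

@[fun_prop]
theorem any {l : α → List β} {f : α → β → Bool} (hl : PT l) (hf : PT fun q : α × β => f q.1 q.2) :
    PT fun x => (l x).any (f x) := by
  refine congr (f := fun x => (l x).foldl (fun acc b => acc || f x b) false)
    (foldl_of_bounded hl (const _) ?_ 3 esize_bool_le) fun x => ?_
  · exact or (by fun_prop) (hf.comp (f := fun q : (α × Bool) × β => (q.1.1, q.2)) (by fun_prop))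
  · have key : ∀ (l : List β) c, l.foldl (fun acc b => acc || f x b) c = (c || l.any (f x)) := by
      intro l
      induction l with
      | nil => simp
      | cons a l ih => intro c; simp [ih, Bool.or_assoc]
    simp [key]

@[fun_prop]
theorem all {l : α → List β} {f : α → β → Bool} (hl : PT l) (hf : PT fun q : α × β => f q.1 q.2) :
    PT fun x => (l x).all (f x) := by
  refine congr (f := fun x => !(l x).any fun y => !f x y) (by fun_prop) fun x => ?_
  simp [List.all_eq_not_any_not]

@[fun_prop]
theorem isEmpty {l : α → List β} (hl : PT l) : PT fun x => (l x).isEmpty :=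
  congr (f := fun x => (l x).casesOn (motive := fun _ => Bool) true fun _ _ => false)
    (by fun_prop) fun x => by cases l x <;> rfl

@[fun_prop]
theorem isSome {o : α → Option β} (ho : PT o) : PT fun x => (o x).isSome :=
  congr (f := fun x => (o x).elim false fun _ => true) (by fun_prop) fun x => by cases o x <;> rfl

@[fun_prop]
theorem optionMap {o : α → Option β} {f : α → β → γ} (ho : PT o)
    (hf : PT fun q : α × β => f q.1 q.2) : PT fun x => (o x).map (f x) :=
  congr (f := fun x => (o x).elim none fun y => Option.some (f x y)) (by fun_prop)
    fun x => by cases o x <;> rfl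

@[fun_prop]
theorem optionBind {o : α → Option β} {f : α → β → Option γ} (ho : PT o)
    (hf : PT fun q : α × β => f q.1 q.2) : PT fun x => (o x).bind (f x) :=
  congr (f := fun x => (o x).elim none fun y => f x y) (by fun_prop)
    fun x => by cases o x <;> rfl

@[fun_prop]
theorem zip {l : α → List β} {l' : α → List γ} (hl : PT l) (hl' : PT l') :
    PT fun x => (l x).zip (l' x) := by
  -- The fold runs over the first list; its state is the unused part of the second list and the
  -- pairs formed so far, in reverse order.
  let step : List γ × List (β × γ) → β → List γ × List (β × γ) := fun q b =>
    q.1.casesOn (motive := fun _ => List γ × List (β × γ)) q fun c t => (t, (b, c) :: q.2)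
  have key : ∀ (l : List β) (l' : List γ) (o : List (β × γ)),
      l.foldl step (l', o) = (l'.drop l.length, (l.zip l').reverse ++ o) := by
    intro l
    induction l with
    | nil => simp
    | cons a l ih =>
      intro l' o
      cases l' with
      | nil => rw [List.foldl_cons, show step ([], o) a = ([], o) from rfl, ih]; simp
      | cons c t => rw [List.foldl_cons, show step (c :: t, o) a = (t, (a, c) :: o) from rfl, ih]; simp
  have hsz : ∀ (l : List β) (l' : List γ), esize (l.zip l') ≤ esize l + esize l' := by
    intro l
    induction l with
    | nil => intro l'; simp [esize_nil]
    | cons a l ih =>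
      intro l'
      cases l' with
      | nil => simp [esize_nil]
      | cons c t =>
        have := ih t
        rw [List.zip_cons_cons, esize_cons, esize_cons, esize_cons, esize_prod]; dsimp only; omega
  refine comp (g := fun q : List β × List γ => q.1.zip q.2) ?_ (hl.prodMk hl')
  refine congr (f := fun q : List β × List γ => (q.1.foldl step (q.2, [])).2.reverse) ?_ fun q => ?_
  · refine reverse (snd.comp (foldl fst (by fun_prop) ?_
      ((IsPoly.id.add .id).add (.const 1)) fun x s hs => ?_))
    · unfold step; fun_prop
    · rw [key, List.append_nil, esize_prod, esize_reverse]
      have h1 := esize_le_of_sublist (List.drop_sublist s.length x.2)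
      have h2 := hsz s x.2
      have h3 := esize_le_of_sublist hs.sublist
      have := esize_prod x
      dsimp only
      omega
  · rw [key]; simp

end PT

/-! ### Binary arithmetic -/

/-- The number with given binary digits, the least significant digit first. -/
def ofDigits (l : List Bool) : ℕ := l.foldr Nat.bit 0

theorem ofDigits_nil : ofDigits [] = 0 := rfl

theorem ofDigits_cons (b : Bool) (l : List Bool) :
    ofDigits (b :: l) = b.toNat + 2 * ofDigits l := by
  rw [ofDigits, List.foldr_cons, Nat.bit_val, ← ofDigits]; omega

theorem ofDigits_append (l l' : List Bool) :
    ofDigits (l ++ l') = ofDigits l + 2 ^ l.length * ofDigits l' := by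
  induction l with
  | nil => simp [ofDigits_nil]
  | cons b l ih => rw [List.cons_append, ofDigits_cons, ofDigits_cons, ih, List.length_cons]; ring

@[simp]
theorem ofDigits_bits (k : ℕ) : ofDigits k.bits = k := by
  induction k using Nat.binaryRec' with
  | zero => simp [ofDigits_nil]
  | bit b n h ih => rw [Nat.bits_append_bit n b h, ofDigits_cons, ih, Nat.bit_val]; omega

theorem esize_nat_le {k m : ℕ} (h : k < 2 ^ m) : esize k ≤ 4 * m + 1 := by
  have := esize_list_le (l := k.bits) (k := m) (B := 3)
    (by rw [Nat.size_eq_bits_len]; exact Nat.size_le.2 h) fun b _ => esize_bool_le b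
  rw [esize_nat]; omega

theorem lt_two_pow_esize (k : ℕ) : k < 2 ^ esize k :=
  Nat.size_le.1 (by rw [← Nat.size_eq_bits_len, esize_nat]; exact length_le_esize _)

namespace PT

@[fun_prop]
theorem bits {f : α → ℕ} (hf : PT f) : PT fun x => (f x).bits := hf.of_enc_eq fun _ => rfl

/-- Leading zeros stand at the end of the list, so a fold from the right meets them first and drops
a zero as long as nothing follows it. -/
theorem bits_ofDigits (l : List Bool) : (ofDigits l).bits =
    l.foldr (fun b acc => bif !b && acc.isEmpty then [] else b :: acc) [] := by
  induction l with
  | nil => simp [ofDigits_nil]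
  | cons b l ih =>
    rw [List.foldr_cons, ← ih, show ofDigits (b :: l) = Nat.bit b (ofDigits l) from rfl]
    by_cases h : ofDigits l = 0 → b = true
    · rw [Nat.bits_append_bit _ _ h]
      cases b
      · have : (ofDigits l).bits ≠ [] := by
          intro h0
          exact absurd (h (by rw [← ofDigits_bits (ofDigits l), h0, ofDigits_nil])) (by simp)
        cases h' : (ofDigits l).bits
        · exact absurd h' this
        · rfl
      · rfl
    · push Not at h
      obtain ⟨h, hb⟩ := h
      rw [h]
      cases b
      · simp
      · exact absurd rfl hb

@[fun_prop]
theorem ofDigits {l : α → List Bool} (hl : PT l) : PT fun x => ofDigits (l x) := by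
  refine of_enc_eq (f := fun x => (HouseAllocation.ofDigits (l x)).bits) ?_ fun _ => rfl
  refine congr (f := fun x => (l x).reverse.foldl
    (fun acc b => bif !b && acc.isEmpty then [] else b :: acc) []) ?_ fun x => ?_
  · obtain ⟨p, hp, h⟩ := hl.exists_esize_le
    refine foldl (reverse hl) (const _) (by fun_prop) ((hp.mul (.const 4)).add (.const 1))
      fun x s hs => ?_
    rw [← List.foldr_reverse, ← bits_ofDigits]
    refine esize_list_le ?_ fun b _ => esize_bool_le b
    have h1 : ∀ l : List Bool, (HouseAllocation.ofDigits l).bits.length ≤ l.length := by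
      intro l
      rw [bits_ofDigits]
      induction l with
      | nil => simp
      | cons b l ih =>
        rw [List.foldr_cons, List.length_cons]
        generalize List.foldr _ _ l = r at *
        cases b <;> cases r <;> simp_all
    refine (h1 _).trans ?_
    rw [List.length_reverse]
    have := hs.length_le
    rw [List.length_reverse] at this
    exact this.trans ((length_le_esize _).trans (h x))
  · rw [bits_ofDigits, List.foldl_reverse]

/-- Adds the digits of a list to a number with given digits and a carry. The result consists of the
remaining digits of the number, the new carry, and the digits of the sum in reverse order. -/
def addDigits (l : List Bool) (b : List Bool) (c : Bool) : List Bool × Bool × List Bool :=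
  l.foldl (fun q x => (q.1.tail, (x && q.1.headD false || (q.2.1 && (x ^^ q.1.headD false))),
    (x ^^ q.1.headD false ^^ q.2.1) :: q.2.2)) (b, c, [])

@[fun_prop]
theorem tail {l : α → List β} (hl : PT l) : PT fun x => (l x).tail :=
  congr (f := fun x => (l x).casesOn (motive := fun _ => List β) [] fun _ t => t)
    (by fun_prop) fun x => by cases l x <;> rfl

@[fun_prop]
theorem headD {l : α → List β} {d : α → β} (hl : PT l) (hd : PT d) : PT fun x => (l x).headD (d x) :=
  congr (f := fun x => (l x).casesOn (motive := fun _ => β) (d x) fun b _ => b)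
    (by fun_prop) fun x => by cases l x <;> rfl

/-- The invariant of schoolbook addition: the digits put out, plus the unread digits of `b` and the
carry shifted by the number of steps, always make up the total. -/
theorem addDigits_spec (l b : List Bool) (c : Bool) :
    (addDigits l b c).1 = b.drop l.length ∧ (addDigits l b c).2.2.length = l.length ∧
      HouseAllocation.ofDigits l + HouseAllocation.ofDigits b + c.toNat =
      HouseAllocation.ofDigits (addDigits l b c).2.2.reverse +
        2 ^ l.length * (HouseAllocation.ofDigits (addDigits l b c).1 + (addDigits l b c).2.1.toNat) := by
  unfold addDigits
  induction l using List.reverseRecOn with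
  | nil => simp [ofDigits_nil]
  | append_singleton l x ih =>
    obtain ⟨h1, h2, h3⟩ := ih
    rw [List.foldl_append]
    simp only [List.foldl_cons, List.foldl_nil, List.length_append, List.length_singleton]
    generalize List.foldl _ _ l = q at *
    obtain ⟨q, c', o⟩ := q
    dsimp only at *
    refine ⟨by rw [h1, List.tail_drop], by rw [List.length_cons, h2], ?_⟩
    rw [List.reverse_cons, ofDigits_append, ofDigits_append, List.length_reverse, h2]
    have hq : HouseAllocation.ofDigits q = (q.headD false).toNat + 2 * HouseAllocation.ofDigits q.tail := by
      cases q
      · rfl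
      · exact ofDigits_cons _ _
    rw [hq] at h3
    have hx : x.toNat + (q.headD false).toNat + c'.toNat = (x ^^ q.headD false ^^ c').toNat +
        2 * (x && q.headD false || (c' && (x ^^ q.headD false))).toNat := by
      cases x <;> cases q.headD false <;> cases c' <;> rfl
    rw [ofDigits_cons, ofDigits_cons, ofDigits_nil, pow_succ]
    linear_combination h3 + 2 ^ l.length * hx

@[fun_prop]
theorem addDigits_comp {l b : α → List Bool} {c : α → Bool} (hl : PT l) (hb : PT b) (hc : PT c) :
    PT fun x => addDigits (l x) (b x) (c x) := by
  refine comp (g := fun q : List Bool × List Bool × Bool => addDigits q.1 q.2.1 q.2.2) ?_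
    (hl.prodMk (hb.prodMk hc))
  refine foldl fst (by fun_prop) (by fun_prop)
    ((IsPoly.id.add (.const 3)).add ((IsPoly.id.mul (.const 4)).add (.const 3)))
    fun x s hs => ?_
  obtain ⟨h1, h2, -⟩ := addDigits_spec s x.2.1 x.2.2
  change esize (addDigits s x.2.1 x.2.2) ≤ _
  generalize addDigits s x.2.1 x.2.2 = q at *
  have h3 := esize_le_of_sublist (List.drop_sublist s.length x.2.1)
  have h4 : esize q.2.2 ≤ _ := esize_list_le (k := esize x) (B := 3) ?_ fun b _ => esize_bool_le b
  · rw [← h1] at h3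
    have := esize_bool_le q.2.1
    have := esize_prod q
    have := esize_prod q.2
    have := esize_prod x
    have := esize_prod x.2
    omega
  · rw [h2]
    have := hs.length_le
    have := length_le_esize x.1
    have := esize_prod x
    omega

@[fun_prop]
theorem add {f g : α → ℕ} (hf : PT f) (hg : PT g) : PT fun x => f x + g x := by
  refine comp (g := fun q : ℕ × ℕ => q.1 + q.2) ?_ (hf.prodMk hg)
  -- `A` adds the second number along the digits of the first; `B` propagates the carry through the
  -- digits of the second number that are left over. The final carry becomes the leading digit.
  let A : ℕ × ℕ → List Bool × Bool × List Bool := fun q => addDigits q.1.bits q.2.bits false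
  let B : ℕ × ℕ → List Bool × Bool × List Bool := fun q => addDigits (A q).1 [] (A q).2.1
  have hA : PT A := by unfold A; fun_prop
  have hB : PT B := by unfold B; fun_prop
  refine congr (f := fun q => HouseAllocation.ofDigits
    ((A q).2.2.reverse ++ ((B q).2.2.reverse ++ [(B q).2.1]))) (by fun_prop) fun q => ?_
  obtain ⟨h1, h2, h3⟩ := addDigits_spec q.1.bits q.2.bits false
  obtain ⟨h4, h5, h6⟩ := addDigits_spec (A q).1 [] (A q).2.1
  change (B q).1 = _ at h4
  rw [List.drop_nil] at h4
  change _ = HouseAllocation.ofDigits (A q).2.2.reverse + 2 ^ q.1.bits.length *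
    (HouseAllocation.ofDigits (A q).1 + (A q).2.1.toNat) at h3
  change _ = HouseAllocation.ofDigits (B q).2.2.reverse + 2 ^ (A q).1.length *
    (HouseAllocation.ofDigits (B q).1 + (B q).2.1.toNat) at h6
  change (A q).2.2.length = _ at h2
  change (B q).2.2.length = _ at h5
  rw [h4, ofDigits_nil] at h6
  rw [ofDigits_append, ofDigits_append, List.length_reverse, List.length_reverse, h2, h5,
    ofDigits_cons, ofDigits_nil]
  simp only [ofDigits_bits, Bool.toNat_false, add_zero, zero_add, mul_zero] at h3 h6 ⊢
  rw [h3, h6]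

@[fun_prop]
theorem mul {f g : α → ℕ} (hf : PT f) (hg : PT g) : PT fun x => f x * g x := by
  refine comp (g := fun q : ℕ × ℕ => q.1 * q.2) ?_ (hf.prodMk hg)
  -- Horner's rule from the most significant digit. Each accumulator is `b` times a leading part of
  -- the first factor, hence at most the product, which yields the size bound.
  have key : ∀ (l : List Bool) (b : ℕ),
      l.foldl (fun acc x => acc + acc + bif x then b else 0) 0 =
        HouseAllocation.ofDigits l.reverse * b := by
    intro l b
    induction l using List.reverseRecOn with
    | nil => simp [ofDigits_nil]
    | append_singleton l x ih =>
      rw [List.foldl_append, ih, List.reverse_append]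
      simp only [List.foldl_cons, List.foldl_nil, List.reverse_singleton, List.singleton_append,
        ofDigits_cons]
      cases x <;> simp <;> ring
  refine congr (f := fun q : ℕ × ℕ => q.1.bits.reverse.foldl
    (fun acc x => acc + acc + bif x then q.2 else 0) 0) ?_ fun q => ?_
  · refine foldl (by fun_prop) (const 0) (by fun_prop) ((IsPoly.const 4 |>.mul .id).add (.const 1))
      fun q s hs => esize_nat_le ?_
    rw [key]
    obtain ⟨t, ht⟩ := hs
    have h1 : HouseAllocation.ofDigits s.reverse ≤ q.1 := by
      have : q.1 = HouseAllocation.ofDigits (s ++ t).reverse := by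
        rw [ht, List.reverse_reverse, ofDigits_bits]
      rw [this, List.reverse_append, ofDigits_append]
      have := Nat.le_mul_of_pos_left (HouseAllocation.ofDigits s.reverse)
        (Nat.pow_pos (a := 2) (n := t.reverse.length) two_pos)
      omega
    calc _ ≤ q.1 * q.2 := Nat.mul_le_mul_right _ h1
      _ < 2 ^ esize q.1 * 2 ^ esize q.2 :=
        Nat.mul_lt_mul'' (lt_two_pow_esize _) (lt_two_pow_esize _)
      _ = 2 ^ (esize q.1 + esize q.2) := (pow_add _ _ _).symm
      _ ≤ _ := Nat.pow_le_pow_right (by norm_num) (by rw [esize_prod q]; omega)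
  · rw [key]; simp

@[fun_prop]
theorem le {f g : α → ℕ} (hf : PT f) (hg : PT g) : PT fun x => decide (f x ≤ g x) := by
  refine comp (g := fun q : ℕ × ℕ => decide (q.1 ≤ q.2)) ?_ (hf.prodMk hg)
  -- Digits arrive least significant first, so the last difference decides and the flag is
  -- overwritten at every differing digit. Its initial value `true` makes the comparison non-strict.
  -- A nonzero digit left over in the second number overrides it.
  let step : List Bool × Bool → Bool → List Bool × Bool := fun q x =>
    (q.1.tail, bif x == q.1.headD false then q.2 else q.1.headD false)
  have hfst : ∀ l b r, (List.foldl step (b, r) l).1 = b.drop l.length := by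
    intro l
    induction l with
    | nil => simp
    | cons x l ih => intro b r; rw [List.foldl_cons, ih]; simp
  have hany : ∀ b : List Bool, b.any (fun x => x) = decide (0 < HouseAllocation.ofDigits b) := by
    intro b
    induction b with
    | nil => rfl
    | cons x b ih => rw [List.any_cons, ih, ofDigits_cons]; cases x <;> simp
  have key : ∀ l b r, ((List.foldl step (b, r) l).2 ||
      (List.foldl step (b, r) l).1.any (fun x => x)) =
      bif r then decide (HouseAllocation.ofDigits l ≤ HouseAllocation.ofDigits b)
        else decide (HouseAllocation.ofDigits l < HouseAllocation.ofDigits b) := by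
    intro l
    induction l with
    | nil => intro b r; rw [List.foldl_nil, hany, ofDigits_nil]; cases r <;> simp
    | cons x l ih =>
      intro b r
      have hq : HouseAllocation.ofDigits b =
          (b.headD false).toNat + 2 * HouseAllocation.ofDigits b.tail := by
        cases b
        · rfl
        · exact ofDigits_cons _ _
      rw [List.foldl_cons, show step (b, r) x =
        (b.tail, bif x == b.headD false then r else b.headD false) from rfl, ih, hq, ofDigits_cons]
      cases x <;> cases b.headD false <;> cases r <;> simp <;> omega
  have hF : PT fun q : ℕ × ℕ => q.1.bits.foldl step (q.2.bits, true) := by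
    refine foldl (by fun_prop) (by fun_prop) (by unfold step; fun_prop) (IsPoly.id.add (.const 4))
      fun q s hs => ?_
    have h1 := esize_prod (s.foldl step (q.2.bits, true))
    rw [hfst] at h1
    have h2 := esize_le_of_sublist (List.drop_sublist s.length q.2.bits)
    have h3 := esize_bool_le (s.foldl step (q.2.bits, true)).2
    rw [← esize_nat] at h2
    have := esize_prod q
    omega
  refine congr (f := fun q : ℕ × ℕ => (q.1.bits.foldl step (q.2.bits, true)).2 ||
      (q.1.bits.foldl step (q.2.bits, true)).1.any (fun x => x)) (by fun_prop) fun q => ?_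
  rw [key]; simp

@[fun_prop]
theorem natEq {f g : α → ℕ} (hf : PT f) (hg : PT g) : PT fun x => decide (f x = g x) := by
  refine congr (f := fun x => decide (f x ≤ g x) && decide (g x ≤ f x)) (by fun_prop) fun x => ?_
  rw [← Bool.decide_and]
  exact decide_eq_decide.2 le_antisymm_iff

@[fun_prop]
theorem length {l : α → List β} (hl : PT l) : PT fun x => (l x).length := by
  have key : ∀ (l : List β) k, l.foldl (fun acc _ => acc + 1) k = l.length + k := by
    intro l
    induction l with
    | nil => simp
    | cons a l ih => intro k; rw [List.foldl_cons, ih, List.length_cons]; omega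
  refine comp (g := fun l : List β => l.length) ?_ hl
  refine congr (f := fun l : List β => l.foldl (fun acc _ => acc + 1) 0) ?_ fun l => ?_
  · refine foldl id (const 0) (by fun_prop) ((IsPoly.const 4 |>.mul .id).add (.const 1))
      fun l s hs => esize_nat_le ?_
    rw [key]
    have := hs.length_le
    have := length_le_esize l
    have := Nat.lt_two_pow_self (n := esize l)
    omega
  · rw [key]; rfl

end PT

/-! ### The dynamic program over the projects and the sets of applicants -/

/-- Fractions `(p - q) / d`, given as `(p, q, d)`. -/
abbrev Frac : Type := ℕ × ℕ × ℕ

/-- Weights as they occur in instances: sign, absolute value of the numerator, denominator. -/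
abbrev RawWeight : Type := (Bool × ℕ) × ℕ

/-- Quotas and row of the weighted adjacency matrix of a project. -/
abbrev Row : Type := ℕ × ℕ × List (Option RawWeight)

/-- A set of applicants is given by the list of the values of its characteristic function. -/
abbrev SetCode : Type := List Bool

/-- The largest weight that was found for each set of applicants. -/
abbrev Table : Type := List (SetCode × Option Frac)

/-- Common factors are not cancelled: denominators simply multiply, and `FracBound` keeps track of
the growth. -/
def addFrac (x y : Frac) : Frac :=
  (x.1 * y.2.2 + y.1 * x.2.2, x.2.1 * y.2.2 + y.2.1 * x.2.2, x.2.2 * y.2.2)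

def leFrac (x y : Frac) : Bool :=
  decide (x.1 * y.2.2 + y.2.1 * x.2.2 ≤ y.1 * x.2.2 + x.2.1 * y.2.2)

def toFrac (w : RawWeight) : Frac := bif w.1.1 then (0, w.1.2, w.2) else (w.1.2, 0, w.2)

def sumFrac (l : List Frac) : Frac := l.foldl addFrac (0, 0, 1)

def maxFrac (l : List Frac) : Option Frac :=
  l.foldl (fun acc v => acc.elim (some v) fun a => bif leFrac a v then some v else some a) none

/-- The entries of a row at the elements of a set. -/
def entries (row : List (Option RawWeight)) (U : SetCode) : List (Option RawWeight) :=
  (row.zip U).filterMap fun e => bif e.2 then some e.1 else none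

/-- The weight of the edges between a project and a set of applicants, if these edges exist. -/
def rowWeight (row : List (Option RawWeight)) (U : SetCode) : Option Frac :=
  bif (entries row U).all fun o => o.isSome then
    some (sumFrac ((entries row U).filterMap fun o => o.map toFrac))
  else none

def codeCard (U : SetCode) : ℕ := (U.filterMap fun b => bif b then some () else none).length

/-- Do the quotas admit the assignment of the set `U`? -/
def quotaOK (r : Row) (U : SetCode) : Bool :=
  decide (codeCard U = 0) || (decide (r.1 ≤ codeCard U) && decide (codeCard U ≤ r.2.1))

/-- Is `S` the disjoint union of `S'` and `U`? -/
def isDisjUnion (S S' U : SetCode) : Bool :=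
  (S.zip (S'.zip U)).all fun e => (e.1 == (e.2.1 || e.2.2)) && !(e.2.1 && e.2.2)

/-- The weight for `S` obtained from an entry of the table by the assignment of `U`. -/
def candidate (r : Row) (S : SetCode) (e : SetCode × Option Frac) (U : SetCode) : Option Frac :=
  bif isDisjUnion S e.1 U && quotaOK r U then
    (rowWeight r.2.2 U).bind fun w => e.2.map fun v => addFrac v w
  else none

def nextTable (sets : List SetCode) (T : Table) (r : Row) : Table :=
  sets.map fun S => (S, maxFrac (T.flatMap fun e => sets.filterMap fun U => candidate r S e U))

/-- Without projects only the empty set can be matched, with weight `0 / 1`; `none` marks sets that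
cannot be matched. -/
def initTable (sets : List SetCode) : Table :=
  sets.map fun S => (S, bif S.all fun b => !b then some (0, 0, 1) else none)

def finalTable (sets : List SetCode) (rows : List Row) : Table :=
  rows.foldl (nextTable sets) (initTable sets)

/-- All sets of applicants. -/
def allSets (u : List Unit) : List SetCode :=
  u.foldl (fun acc _ => (acc.map fun l => true :: l) ++ acc.map fun l => false :: l) [[]]

/-- The decision procedure for the weighted problem. -/
def solve (I : List Unit × List Row × RawWeight) : Bool :=
  (finalTable (allSets I.1) I.2.1).any fun e => e.2.elim false fun v => leFrac (toFrac I.2.2) v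

/-! ### Size bounds -/

/-- A bound for sums of `k` fractions with numerators and denominators of `B` bits. -/
def FracBound (k B : ℕ) (v : Frac) : Prop :=
  v.1 ≤ k * 2 ^ (k * B) ∧ v.2.1 ≤ k * 2 ^ (k * B) ∧ v.2.2 ≤ 2 ^ (k * B)

/-- The bound is additive in the number of summands, so a sum of polynomially many fractions has
polynomially many bits even without cancellation. -/
theorem FracBound.add {k j B : ℕ} {x y : Frac} (hx : FracBound k B x) (hy : FracBound j B y) :
    FracBound (k + j) B (addFrac x y) := by
  obtain ⟨h1, h2, h3⟩ := hx
  obtain ⟨h4, h5, h6⟩ := hy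
  have e : 2 ^ ((k + j) * B) = 2 ^ (k * B) * 2 ^ (j * B) := by rw [add_mul, pow_add]
  have hn : ∀ a b : ℕ, a ≤ k * 2 ^ (k * B) → b ≤ j * 2 ^ (j * B) →
      a * y.2.2 + b * x.2.2 ≤ (k + j) * 2 ^ ((k + j) * B) := fun a b ha hb => by
    calc a * y.2.2 + b * x.2.2
        ≤ k * 2 ^ (k * B) * 2 ^ (j * B) + j * 2 ^ (j * B) * 2 ^ (k * B) :=
          Nat.add_le_add (Nat.mul_le_mul ha h6) (Nat.mul_le_mul hb h3)
      _ = _ := by rw [e]; ring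
  exact ⟨hn _ _ h1 h4, hn _ _ h2 h5, (Nat.mul_le_mul h3 h6).trans_eq e.symm⟩

theorem FracBound.mono {k j B : ℕ} {x : Frac} (hx : FracBound k B x) (h : k ≤ j) :
    FracBound j B x := by
  have e : 2 ^ (k * B) ≤ 2 ^ (j * B) :=
    Nat.pow_le_pow_right two_pos (Nat.mul_le_mul_right _ h)
  exact ⟨hx.1.trans (Nat.mul_le_mul h e), hx.2.1.trans (Nat.mul_le_mul h e), hx.2.2.trans e⟩

theorem FracBound.zero (B : ℕ) : FracBound 0 B (0, 0, 1) := by simp [FracBound]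

theorem FracBound.of_esize {v : Frac} {B : ℕ} (h : esize v ≤ B) : FracBound 1 B v := by
  have key : ∀ k : ℕ, esize k ≤ B → k ≤ 2 ^ B := fun k hk =>
    (lt_two_pow_esize k).le.trans (Nat.pow_le_pow_right two_pos hk)
  rw [esize_prod, esize_prod] at h
  simp only [FracBound, one_mul]
  exact ⟨key _ (by omega), key _ (by omega), key _ (by omega)⟩

theorem FracBound.esize_le {v : Frac} {k B : ℕ} (h : FracBound k B v) :
    esize v ≤ 12 * (k + k * B + 1) + 5 := by
  have h1 : k * 2 ^ (k * B) < 2 ^ (k + k * B + 1) := by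
    rw [pow_succ, pow_add]
    have := Nat.mul_le_mul_right (2 ^ (k * B)) (Nat.lt_two_pow_self (n := k)).le
    have := Nat.pow_pos (a := 2) (n := k) two_pos
    have := Nat.pow_pos (a := 2) (n := k * B) two_pos
    nlinarith
  have h2 : 2 ^ (k * B) < 2 ^ (k + k * B + 1) := Nat.pow_lt_pow_right (by norm_num) (by omega)
  have a := esize_nat_le (h.1.trans_lt h1)
  have b := esize_nat_le (h.2.1.trans_lt h1)
  have c := esize_nat_le (h.2.2.trans_lt h2)
  rw [esize_prod, esize_prod]
  omega

theorem FracBound.toFrac {w : RawWeight} {B : ℕ} (h : esize w ≤ B) : FracBound 1 B (toFrac w) := by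
  have key : ∀ k : ℕ, esize k ≤ B → k ≤ 2 ^ B := fun k hk =>
    (lt_two_pow_esize k).le.trans (Nat.pow_le_pow_right two_pos hk)
  rw [esize_prod, esize_prod] at h
  have h1 := key w.1.2 (by omega)
  have h2 := key w.2 (by omega)
  unfold HouseAllocation.toFrac
  cases w.1.1 <;> simp [FracBound, h1, h2]

theorem FracBound.sumFrac {l : List Frac} {B : ℕ} (h : ∀ v ∈ l, FracBound 1 B v) :
    FracBound l.length B (sumFrac l) := by
  unfold HouseAllocation.sumFrac
  induction l using List.reverseRecOn with
  | nil => exact .zero B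
  | append_singleton l x ih =>
    rw [List.foldl_append, List.length_append]
    exact (ih fun v hv => h v (by simp [hv])).add (h x (by simp))

theorem mem_of_maxFrac {l : List Frac} {v : Frac} (h : maxFrac l = some v) : v ∈ l := by
  unfold maxFrac at h
  induction l using List.reverseRecOn generalizing v with
  | nil => simp at h
  | append_singleton l x ih =>
    rw [List.foldl_append] at h
    simp only [List.foldl_cons, List.foldl_nil] at h
    generalize List.foldl _ _ l = r at *
    cases r with
    | none => simp at h; simp [h]
    | some a =>
      simp only [Option.elim_some] at h
      cases hl : leFrac a x
      · rw [hl] at h; simp at h; subst h; simp [ih rfl]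
      · rw [hl] at h; simp at h; simp [h]

/-! ### Polynomial running times -/

namespace PT

@[fun_prop]
theorem addFrac {f g : α → Frac} (hf : PT f) (hg : PT g) : PT fun x => addFrac (f x) (g x) := by
  unfold HouseAllocation.addFrac; fun_prop

@[fun_prop]
theorem leFrac {f g : α → Frac} (hf : PT f) (hg : PT g) : PT fun x => leFrac (f x) (g x) := by
  unfold HouseAllocation.leFrac; fun_prop

@[fun_prop]
theorem toFrac {f : α → RawWeight} (hf : PT f) : PT fun x => toFrac (f x) := by
  unfold HouseAllocation.toFrac; fun_prop

@[fun_prop]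
theorem sumFrac {f : α → List Frac} (hf : PT f) : PT fun x => sumFrac (f x) := by
  refine comp (g := HouseAllocation.sumFrac) ?_ hf
  refine foldl (step := fun _ => HouseAllocation.addFrac) id (const _) (by fun_prop)
    (p := fun n => 12 * (n + n * n + 1) + 5)
    (.add (.mul (.const 12) (.add (.add .id (.mul .id .id)) (.const 1))) (.const 5)) fun l s hs => ?_
  refine (((FracBound.sumFrac fun v hv => ?_).mono ?_).esize_le (k := esize l) (B := esize l))
  · exact .of_esize (esize_le_of_mem (hs.subset hv))
  · exact hs.length_le.trans (length_le_esize l)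

@[fun_prop]
theorem maxFrac {f : α → List Frac} (hf : PT f) : PT fun x => maxFrac (f x) := by
  refine comp (g := HouseAllocation.maxFrac) ?_ hf
  refine foldl (step := fun _ acc v => acc.elim (Option.some v) fun a =>
    bif HouseAllocation.leFrac a v then Option.some v else Option.some a) id (const none)
    (by fun_prop) (.add .id (.const 2)) fun l s hs => ?_
  change esize (HouseAllocation.maxFrac s) ≤ _
  cases h : HouseAllocation.maxFrac s with
  | none => simp [esize_none]
  | some v =>
    rw [esize_some]
    exact Nat.add_le_add_right (esize_le_of_mem (hs.subset (mem_of_maxFrac h))) 2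

@[fun_prop]
theorem entries {f : α → List (Option RawWeight)} {U : α → SetCode} (hf : PT f) (hU : PT U) :
    PT fun x => entries (f x) (U x) := by
  unfold HouseAllocation.entries; fun_prop

@[fun_prop]
theorem rowWeight {f : α → List (Option RawWeight)} {U : α → SetCode} (hf : PT f) (hU : PT U) :
    PT fun x => rowWeight (f x) (U x) := by
  unfold HouseAllocation.rowWeight; fun_prop

@[fun_prop]
theorem codeCard {U : α → SetCode} (hU : PT U) : PT fun x => codeCard (U x) := by
  unfold HouseAllocation.codeCard; fun_prop

@[fun_prop]
theorem quotaOK {r : α → Row} {U : α → SetCode} (hr : PT r) (hU : PT U) :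
    PT fun x => quotaOK (r x) (U x) := by
  unfold HouseAllocation.quotaOK; fun_prop

@[fun_prop]
theorem isDisjUnion {S S' U : α → SetCode} (hS : PT S) (hS' : PT S') (hU : PT U) :
    PT fun x => isDisjUnion (S x) (S' x) (U x) := by
  unfold HouseAllocation.isDisjUnion; fun_prop

@[fun_prop]
theorem candidate {r : α → Row} {S : α → SetCode} {e : α → SetCode × Option Frac} {U : α → SetCode}
    (hr : PT r) (hS : PT S) (he : PT e) (hU : PT U) :
    PT fun x => candidate (r x) (S x) (e x) (U x) := by
  unfold HouseAllocation.candidate; fun_prop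

@[fun_prop]
theorem nextTable {A : α → List SetCode} {T : α → Table} {r : α → Row}
    (hA : PT A) (hT : PT T) (hr : PT r) : PT fun x => nextTable (A x) (T x) (r x) := by
  unfold HouseAllocation.nextTable; fun_prop

@[fun_prop]
theorem initTable {A : α → List SetCode} (hA : PT A) : PT fun x => initTable (A x) := by
  unfold HouseAllocation.initTable; fun_prop

end PT

/-- A row of size at most `B` has at most `B` entries, and each of them has at most `B` bits. -/
theorem FracBound.rowWeight {row : List (Option RawWeight)} {U : SetCode} {v : Frac} {B : ℕ}
    (hB : esize row ≤ B) (h : rowWeight row U = some v) : FracBound B B v := by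
  unfold HouseAllocation.rowWeight at h
  cases h' : (entries row U).all fun o => o.isSome
  · simp [h'] at h
  · rw [h', cond_true, Option.some_inj] at h
    subst h
    refine (FracBound.sumFrac fun v hv => ?_).mono ?_
    · obtain ⟨o, ho, hv⟩ := List.mem_filterMap.1 hv
      obtain ⟨w, rfl, rfl⟩ := Option.map_eq_some_iff.1 hv
      obtain ⟨⟨o', b⟩, he, ho'⟩ := List.mem_filterMap.1 ho
      cases b
      · simp at ho'
      · simp at ho'
        subst ho'
        have := esize_le_of_mem (List.of_mem_zip he).1
        rw [esize_some] at this
        exact .toFrac (by omega)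
    · refine (List.length_filterMap_le _ _).trans ((List.length_filterMap_le _ _).trans ?_)
      rw [List.length_zip]
      exact (min_le_left _ _).trans ((length_le_esize row).trans hB)

/-- Each project adds one row weight, that is at most `B` fractions, to an earlier entry. The bound
for the weights is therefore independent of the number of sets. -/
theorem finalTable_bound {sets : List SetCode} {rows : List Row} {B : ℕ}
    (hrows : esize rows ≤ B) :
    (finalTable sets rows).length = sets.length ∧ ∀ e ∈ finalTable sets rows, e.1 ∈ sets ∧
      ∀ v, e.2 = some v → FracBound (rows.length * B) B v := by
  unfold finalTable
  induction rows using List.reverseRecOn with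
  | nil =>
    refine ⟨List.length_map _, fun e he => ?_⟩
    obtain ⟨S, hS, rfl⟩ := List.mem_map.1 he
    refine ⟨hS, fun v hv => ?_⟩
    dsimp only at hv
    cases h : S.all fun b => !b
    · rw [h] at hv; cases hv
    · rw [h] at hv
      cases hv
      exact (FracBound.zero B).mono (Nat.zero_le _)
  | append_singleton rows r ih =>
    obtain ⟨-, ih⟩ := ih ((esize_le_of_sublist (List.sublist_append_left _ _)).trans hrows)
    rw [List.foldl_append, List.foldl_cons, List.foldl_nil, List.length_append,
      List.length_singleton, add_mul, one_mul]
    refine ⟨List.length_map _, fun e he => ?_⟩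
    obtain ⟨S, hS, rfl⟩ := List.mem_map.1 he
    refine ⟨hS, fun v hv => ?_⟩
    obtain ⟨e', he', hv'⟩ := List.mem_flatMap.1 (mem_of_maxFrac hv)
    obtain ⟨U, hU, hv'⟩ := List.mem_filterMap.1 hv'
    unfold candidate at hv'
    cases h : isDisjUnion S e'.1 U && quotaOK r U
    · rw [h] at hv'; cases hv'
    · rw [h, cond_true] at hv'
      obtain ⟨w, hw, hv'⟩ := Option.bind_eq_some_iff.1 hv'
      obtain ⟨v', hv'', rfl⟩ := Option.map_eq_some_iff.1 hv'
      refine ((ih e' he').2 v' hv'').add (.rowWeight ?_ hw)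
      have h1 := (esize_le_of_mem (a := r) (l := rows ++ [r]) (by simp)).trans hrows
      rw [esize_prod, esize_prod] at h1
      omega

namespace PT

@[fun_prop]
theorem finalTable {A : α → List SetCode} {r : α → List Row} (hA : PT A) (hr : PT r) :
    PT fun x => finalTable (A x) (r x) := by
  refine comp (g := fun q : List SetCode × List Row => HouseAllocation.finalTable q.1 q.2) ?_
    (hA.prodMk hr)
  -- The number of entries times the bound for one entry: a code, and a weight estimated by
  -- `FracBound.esize_le` with `k = n * n` and `B = n`, where `some` adds `2`.
  have hp : IsPoly fun n => n * (n + (12 * (n * n + n * n * n + 1) + 7) + 1 + 1) + 1 := by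
    have h2 : IsPoly fun n => n * n := .mul .id .id
    exact (IsPoly.id.mul (((IsPoly.id.add (((IsPoly.const 12).mul ((h2.add (h2.mul .id)).add
      (.const 1))).add (.const 7))).add (.const 1)).add (.const 1))).add (.const 1)
  refine foldl (b := fun q => HouseAllocation.initTable q.1)
    (step := fun q : List SetCode × List Row => HouseAllocation.nextTable q.1) snd (by fun_prop)
    (by fun_prop) hp fun q s hs => ?_
  have hs' := esize_le_of_sublist hs.sublist
  have hq := esize_prod q
  obtain ⟨h1, h2⟩ := finalTable_bound (sets := q.1) (rows := s) (B := esize q) (by omega)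
  have h3 := length_le_esize q.1
  have h4 := length_le_esize s
  refine esize_list_le (h1.trans_le (by omega)) fun e he => ?_
  obtain ⟨h5, h6⟩ := h2 e he
  have h7 := esize_le_of_mem h5
  have h8 : esize e.2 ≤ 12 * (esize q * esize q + esize q * esize q * esize q + 1) + 7 := by
    cases h : e.2 with
    | none => rw [esize_none]; omega
    | some v =>
      rw [esize_some]
      exact Nat.add_le_add_right
        ((h6 v h).mono (Nat.mul_le_mul_right _ (h4.trans (by omega)))).esize_le 2
  rw [esize_prod]
  omega

end PT

theorem allSets_bound (u : List Unit) :
    (allSets u).length ≤ 2 ^ u.length ∧ ∀ S ∈ allSets u, esize S ≤ 4 * u.length + 1 := by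
  unfold allSets
  induction u using List.reverseRecOn with
  | nil => simp [esize_nil]
  | append_singleton u x ih =>
    obtain ⟨h1, h2⟩ := ih
    rw [List.foldl_append, List.foldl_cons, List.foldl_nil, List.length_append]
    generalize List.foldl _ _ u = r at *
    refine ⟨?_, fun S hS => ?_⟩
    · rw [List.length_append, List.length_map, List.length_map, List.length_singleton, pow_succ]
      omega
    · rw [List.length_append, List.length_singleton]
      rcases List.mem_append.1 hS with hS | hS
      all_goals
        obtain ⟨S', hS', rfl⟩ := List.mem_map.1 hS
        have := h2 S' hS'
        rw [esize_cons]
      · have := esize_bool_le true; omega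
      · have := esize_bool_le false; omega

/-- After the sets have been listed, the procedure is polynomial in the list of sets and the
instance together, both of which are polynomial in `2 ^ n` times the size of the instance. -/
theorem ptn_solve : PTN (fun I : List Unit × List Row × RawWeight => 2 ^ I.1.length * esize I)
    solve := by
  set N := fun I : List Unit × List Row × RawWeight => 2 ^ I.1.length * esize I
  have hN : ∀ I, esize I ≤ N I := fun I => Nat.le_mul_of_pos_left _ (Nat.pow_pos two_pos)
  have hid : PTN N fun I => I := by
    refine .of_expr .id hN (.hd (.var 0)) fun x r s h => ?_
    simp [Expr.eval, h, Data.hd]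
  have hall : PTN N fun I => allSets I.1 := by
    refine PTN.foldl (step := fun _ acc _ => _) (hid.comp (g := fun I => I.1) (by fun_prop))
      (PTN.comp (g := fun _ => [[]]) (PT.const _) hid) (by fun_prop)
      (((IsPoly.const 6).mul .id).add (.const 1)) (fun x => ?_) fun x s hs => ?_
    · have := hN x; omega
    · obtain ⟨h1, h2⟩ := allSets_bound s
      have hs' : s.length ≤ x.1.length := hs.length_le
      have h3 := esize_list_le h1 h2
      have h4 : 4 * s.length + 1 + 1 ≤ 6 * esize x := by
        have := length_le_esize x.1
        have := esize_prod x
        omega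
      refine h3.trans (Nat.add_le_add_right ?_ 1)
      calc _ ≤ 2 ^ x.1.length * (6 * esize x) :=
            Nat.mul_le_mul (Nat.pow_le_pow_right two_pos hs') h4
        _ = _ := by simp only [N]; ring
  refine (PTN.comp (g := fun q : List SetCode × List Unit × List Row × RawWeight =>
    (finalTable q.1 q.2.2.1).any fun e => e.2.elim false fun v => leFrac (toFrac q.2.2.2) v)
    (by fun_prop) (hall.prodMk hid))

/-! ### Correctness of the dynamic program -/

/-- The value of a fraction. -/
def Frac.toRat (v : Frac) : ℚ := ((v.1 : ℚ) - v.2.1) / v.2.2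

/-- The value of a weight. -/
def RawWeight.toRat (w : RawWeight) : ℚ := Frac.toRat (toFrac w)

theorem toRat_addFrac {x y : Frac} (hx : 0 < x.2.2) (hy : 0 < y.2.2) :
    0 < (addFrac x y).2.2 ∧ (addFrac x y).toRat = x.toRat + y.toRat := by
  refine ⟨Nat.mul_pos hx hy, ?_⟩
  have : (x.2.2 : ℚ) ≠ 0 := by positivity
  have : (y.2.2 : ℚ) ≠ 0 := by positivity
  simp only [Frac.toRat, addFrac]
  push_cast
  field_simp
  ring

theorem leFrac_iff {x y : Frac} (hx : 0 < x.2.2) (hy : 0 < y.2.2) :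
    leFrac x y = true ↔ x.toRat ≤ y.toRat := by
  have hx' : (0 : ℚ) < x.2.2 := by exact_mod_cast hx
  have hy' : (0 : ℚ) < y.2.2 := by exact_mod_cast hy
  rw [leFrac, decide_eq_true_iff, Frac.toRat, Frac.toRat, div_le_div_iff₀ hx' hy',
    ← Nat.cast_le (α := ℚ)]
  push_cast
  constructor <;> intro h <;> linarith

theorem toRat_sumFrac {l : List Frac} (hl : ∀ v ∈ l, 0 < v.2.2) :
    0 < (sumFrac l).2.2 ∧ (sumFrac l).toRat = (l.map Frac.toRat).sum := by
  unfold sumFrac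
  induction l using List.reverseRecOn with
  | nil => simp [Frac.toRat]
  | append_singleton l x ih =>
    obtain ⟨h1, h2⟩ := ih fun v hv => hl v (by simp [hv])
    obtain ⟨h3, h4⟩ := toRat_addFrac h1 (hl x (by simp))
    rw [List.foldl_append, List.foldl_cons, List.foldl_nil]
    refine ⟨h3, ?_⟩
    rw [h4, h2]
    simp

theorem exists_maxFrac {l : List Frac} (hl : ∀ v ∈ l, 0 < v.2.2) {v : Frac} (hv : v ∈ l) :
    ∃ w, maxFrac l = some w ∧ v.toRat ≤ w.toRat := by
  induction l using List.reverseRecOn generalizing v with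
  | nil => simp at hv
  | append_singleton l x ih =>
    have ih' := fun {v} => ih (fun v hv => hl v (by simp [hv])) (v := v)
    have hx : 0 < x.2.2 := hl x (by simp)
    have e : maxFrac (l ++ [x]) = (maxFrac l).elim (some x) fun a =>
      bif leFrac a x then some x else some a := by simp [maxFrac]
    rw [e]
    cases h : maxFrac l with
    | none =>
      refine ⟨x, rfl, ?_⟩
      rcases List.mem_append.1 hv with hv | hv
      · obtain ⟨w, hw, -⟩ := ih' hv
        rw [h] at hw; cases hw
      · rw [List.mem_singleton.1 hv]
    | some a =>
      have ha : 0 < a.2.2 := hl a (by simp [mem_of_maxFrac h])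
      have hva : v ∈ l → v.toRat ≤ a.toRat := fun hv => by
        obtain ⟨w, hw, hvw⟩ := ih' hv
        rw [h] at hw; cases hw; exact hvw
      cases hle : leFrac a x
      · refine ⟨a, by simp [hle], ?_⟩
        rcases List.mem_append.1 hv with hv | hv
        · exact hva hv
        · rw [List.mem_singleton.1 hv]
          exact (not_le.1 fun h' => by rw [(leFrac_iff ha hx).2 h'] at hle; cases hle).le
      · refine ⟨x, by simp [hle], ?_⟩
        rcases List.mem_append.1 hv with hv | hv
        · exact (hva hv).trans ((leFrac_iff ha hx).1 hle)
        · rw [List.mem_singleton.1 hv]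

variable {n m : ℕ}

/-- The code of a set of applicants. -/
def code (S : Finset (Fin n)) : SetCode := List.ofFn fun a => decide (a ∈ S)

theorem code_eq_map (S : Finset (Fin n)) :
    code S = (List.finRange n).map fun a => decide (a ∈ S) := List.ofFn_eq_map

theorem mem_allSets (u : List Unit) (l : SetCode) : l ∈ allSets u ↔ l.length = u.length := by
  unfold allSets
  induction u using List.reverseRecOn generalizing l with
  | nil => simp
  | append_singleton u x ih =>
    rw [List.foldl_append, List.foldl_cons, List.foldl_nil]
    simp only [List.mem_append, List.mem_map, ih]
    cases l with
    | nil => simp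
    | cons b l => cases b <;> simp

theorem mem_allSets_iff (l : SetCode) :
    l ∈ allSets (List.replicate n ()) ↔ ∃ S : Finset (Fin n), l = code S := by
  rw [mem_allSets, List.length_replicate]
  constructor
  · intro h
    subst h
    refine ⟨Finset.univ.filter fun a => l.get a = true, ?_⟩
    simp [code]
  · rintro ⟨S, rfl⟩
    simp [code]

theorem toFinset_filter_finRange (U : Finset (Fin n)) :
    ((List.finRange n).filter fun a => decide (a ∈ U)).toFinset = U := by
  ext a; simp

theorem nodup_filter_finRange (U : Finset (Fin n)) :
    ((List.finRange n).filter fun a => decide (a ∈ U)).Nodup := (List.nodup_finRange n).filter _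

theorem filterMap_cond {α β : Type*} (c : α → Bool) (f : α → β) (l : List α) :
    (l.filterMap fun a => bif c a then some (f a) else none) = (l.filter c).map f := by
  induction l with
  | nil => rfl
  | cons a l ih => cases h : c a <;> simp [h, ih]

theorem codeCard_code (U : Finset (Fin n)) : codeCard (code U) = U.card := by
  rw [codeCard, code_eq_map, List.filterMap_map]
  have := filterMap_cond (fun a => decide (a ∈ U)) (fun _ => ()) (List.finRange n)
  change (List.filterMap (fun a => bif decide (a ∈ U) then some () else none) _).length = _
  rw [this, List.length_map, ← List.toFinset_card_of_nodup (nodup_filter_finRange U),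
    toFinset_filter_finRange]

theorem isDisjUnion_code (S S' U : Finset (Fin n)) :
    isDisjUnion (code S) (code S') (code U) = true ↔ Disjoint S' U ∧ S = S' ∪ U := by
  rw [isDisjUnion, code_eq_map, code_eq_map, code_eq_map, List.zip_map', List.zip_map',
    List.all_map, List.all_eq_true, Finset.disjoint_left, Finset.ext_iff, ← forall_and]
  simp only [List.mem_finRange, true_imp_iff, Function.comp, Finset.mem_union]
  refine forall_congr' fun a => ?_
  by_cases h : a ∈ S <;> by_cases h' : a ∈ S' <;> by_cases h'' : a ∈ U <;> simp [h, h', h'']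

theorem quotaOK_code (lo up : ℕ) (row : List (Option RawWeight)) (U : Finset (Fin n)) :
    quotaOK (lo, up, row) (code U) = true ↔ U.card = 0 ∨ lo ≤ U.card ∧ U.card ≤ up := by
  simp [quotaOK, codeCard_code]

theorem entries_code (w : Fin n → Option RawWeight) (U : Finset (Fin n)) :
    entries (List.ofFn w) (code U) = ((List.finRange n).filter fun a => decide (a ∈ U)).map w := by
  rw [entries, code_eq_map, List.ofFn_eq_map, List.zip_map', List.filterMap_map, ← filterMap_cond]
  rfl

theorem rowWeight_code (w : Fin n → Option RawWeight) (hw : ∀ a x, w a = some x → 0 < x.2)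
    (U : Finset (Fin n)) :
    ((∃ v, rowWeight (List.ofFn w) (code U) = some v) ↔ ∀ a ∈ U, (w a).isSome) ∧
      ∀ v, rowWeight (List.ofFn w) (code U) = some v →
        0 < v.2.2 ∧ v.toRat = ∑ a ∈ U, (w a).elim 0 RawWeight.toRat := by
  have h1 : ((entries (List.ofFn w) (code U)).all fun o => o.isSome) = true ↔
      ∀ a ∈ U, (w a).isSome := by
    rw [entries_code]
    simpa using forall_congr' fun a => imp_iff_not_or.symm
  rw [rowWeight]
  cases h : (entries (List.ofFn w) (code U)).all fun o => o.isSome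
  · rw [h] at h1
    rw [← h1]
    simp
  · rw [h] at h1
    rw [cond_true, ← h1]
    refine ⟨by simp, fun v hv => ?_⟩
    rw [Option.some_inj] at hv
    subst hv
    have hpos : ∀ v ∈ (entries (List.ofFn w) (code U)).filterMap fun o => o.map toFrac,
        0 < v.2.2 := by
      intro v hv
      obtain ⟨o, ho, hv⟩ := List.mem_filterMap.1 hv
      rw [entries_code] at ho
      obtain ⟨a, -, rfl⟩ := List.mem_map.1 ho
      obtain ⟨x, hx, rfl⟩ := Option.map_eq_some_iff.1 hv
      have := hw a x hx
      unfold toFrac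
      cases x.1.1 <;> simpa using this
    obtain ⟨h2, h3⟩ := toRat_sumFrac hpos
    refine ⟨h2, h3.trans ?_⟩
    conv_rhs => rw [← toFinset_filter_finRange U, List.sum_toFinset _ (nodup_filter_finRange U)]
    rw [entries_code]
    have h1 := h1.1 rfl
    have h4 : ∀ l : List (Fin n), (∀ a ∈ l, (w a).isSome) →
        ((List.filterMap (fun o => o.map toFrac) (l.map w)).map Frac.toRat).sum =
        (l.map fun a => (w a).elim 0 RawWeight.toRat).sum := by
      intro l
      induction l with
      | nil => simp
      | cons a l ih =>
        intro hl
        have := ih fun b hb => hl b (by simp [hb])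
        obtain ⟨x, hx⟩ := Option.isSome_iff_exists.1 (hl a (by simp))
        simp only [List.map_cons, List.sum_cons, ← this]
        simp [hx, RawWeight.toRat]
    exact h4 _ fun a ha => h1 a (by simpa using ha)

/-- The set `S` can be matched with total weight `q`. -/
def Feasible (lo up : Fin m → ℕ) (w : Fin m → Fin n → Option RawWeight) (S : Finset (Fin n))
    (q : ℚ) : Prop :=
  ∃ M : Fin n → Option (Fin m), (∀ a p, M a = some p → (w p a).isSome) ∧
    (∀ p, (Finset.univ.filter fun a => M a = some p).card = 0 ∨
      lo p ≤ (Finset.univ.filter fun a => M a = some p).card ∧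
      (Finset.univ.filter fun a => M a = some p).card ≤ up p) ∧
    S = (Finset.univ.filter fun a => (M a).isSome) ∧
    q = ∑ a, (M a).elim 0 fun p => (w p a).elim 0 RawWeight.toRat

/-- The solutions obtained from those in `X` by the assignment of a set to a further project. -/
def Extend (X : Finset (Fin n) → ℚ → Prop) (lo up : ℕ) (w : Fin n → Option RawWeight)
    (S : Finset (Fin n)) (q : ℚ) : Prop :=
  ∃ S' U q', X S' q' ∧ Disjoint S' U ∧ S = S' ∪ U ∧ (∀ a ∈ U, (w a).isSome) ∧
    (U.card = 0 ∨ lo ≤ U.card ∧ U.card ≤ up) ∧ q = q' + ∑ a ∈ U, (w a).elim 0 RawWeight.toRat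

/-- An assignment to `m + 1` projects is the same as an assignment to the first `m` together with a
disjoint set `U` for the last one. -/
theorem feasible_succ (lo up : Fin (m + 1) → ℕ) (w : Fin (m + 1) → Fin n → Option RawWeight)
    (S : Finset (Fin n)) (q : ℚ) : Feasible lo up w S q ↔
      Extend (Feasible (fun p => lo p.castSucc) (fun p => up p.castSucc) fun p => w p.castSucc)
        (lo (Fin.last m)) (up (Fin.last m)) (w (Fin.last m)) S q := by
  -- Serves both directions. Applicants in `U` are unmatched in `M'`, so each applicant contributes
  -- to at most one of the two sums on the right.
  have sum : ∀ (M : Fin n → Option (Fin (m + 1))) (M' : Fin n → Option (Fin m))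
      (U : Finset (Fin n)), (∀ a, M a = some (Fin.last m) ↔ a ∈ U) →
      (∀ a p, M a = some (Fin.castSucc p) ↔ M' a = some p) →
      (∑ a, (M a).elim 0 fun p => (w p a).elim 0 RawWeight.toRat) =
        (∑ a, (M' a).elim 0 fun p => (w p.castSucc a).elim 0 RawWeight.toRat) +
          ∑ a ∈ U, (w (Fin.last m) a).elim 0 RawWeight.toRat := by
    intro M M' U h1 h2
    rw [← Finset.sum_filter_add_sum_filter_not Finset.univ (· ∈ U)]
    rw [add_comm, Finset.sum_filter, Finset.sum_filter]
    have e : ∑ a ∈ U, (w (Fin.last m) a).elim 0 RawWeight.toRat =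
        ∑ a, if a ∈ U then (w (Fin.last m) a).elim 0 RawWeight.toRat else 0 := by simp
    rw [e, ← Finset.sum_add_distrib, ← Finset.sum_add_distrib]
    refine Finset.sum_congr rfl fun a _ => ?_
    by_cases ha : a ∈ U
    · have h3 := (h1 a).2 ha
      have h4 : M' a = none := by
        cases h : M' a with
        | none => rfl
        | some p =>
          have := (h2 a p).2 h
          rw [h3, Option.some_inj] at this
          exact absurd this (Fin.castSucc_lt_last p).ne'
      simp [ha, h3, h4]
    · simp only [ha, not_false_eq_true, if_true, if_false, add_zero]
      cases h : M a with
      | none =>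
        cases h' : M' a with
        | none => rfl
        | some p => rw [(h2 a p).2 h'] at h; cases h
      | some p =>
        induction p using Fin.lastCases with
        | last => exact absurd ((h1 a).1 h) ha
        | cast p => rw [(h2 a p).1 h]; rfl
  constructor
  · rintro ⟨M, hE, hQ, rfl, rfl⟩
    set U : Finset (Fin n) := Finset.univ.filter fun a => M a = some (Fin.last m)
    set M' : Fin n → Option (Fin m) := fun a => (M a).bind fun p =>
      if h : p ≠ Fin.last m then some (p.castPred h) else none
    have h1 : ∀ a, M a = some (Fin.last m) ↔ a ∈ U := by simp [U]
    have h2 : ∀ a p, M a = some (Fin.castSucc p) ↔ M' a = some p := by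
      intro a p
      simp only [M']
      cases h : M a with
      | none => simp
      | some r =>
        induction r using Fin.lastCases with
        | last => simp [(Fin.castSucc_lt_last p).ne']
        | cast r => simp
    refine ⟨Finset.univ.filter fun a => (M' a).isSome, U, _, ⟨M', fun a p h => ?_, fun p => ?_, rfl,
      rfl⟩, ?_, ?_, fun a ha => hE a _ ((h1 a).2 ha), hQ (Fin.last m), sum M M' U h1 h2⟩
    · exact hE a _ ((h2 a p).2 h)
    · simp only [← h2]; exact hQ p.castSucc
    · rw [Finset.disjoint_left]
      intro a ha haU
      obtain ⟨p, hp⟩ := Option.isSome_iff_exists.1 (Finset.mem_filter.1 ha).2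
      have := ((h1 a).2 haU).symm.trans ((h2 a p).2 hp)
      exact absurd (Option.some_inj.1 this) (Fin.castSucc_lt_last p).ne'
    · ext a
      simp only [Finset.mem_filter, Finset.mem_univ, true_and, Finset.mem_union, ← h1,
        Option.isSome_iff_exists, ← h2]
      constructor
      · rintro ⟨p, hp⟩
        induction p using Fin.lastCases with
        | last => exact .inr hp
        | cast p => exact .inl ⟨p, hp⟩
      · rintro (⟨p, hp⟩ | hp)
        exacts [⟨_, hp⟩, ⟨_, hp⟩]
  · rintro ⟨_, U, _, ⟨M', hE, hQ, rfl, rfl⟩, hd, rfl, hU, hQU, rfl⟩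
    set M : Fin n → Option (Fin (m + 1)) := fun a =>
      if a ∈ U then some (Fin.last m) else (M' a).map Fin.castSucc
    have h1 : ∀ a, M a = some (Fin.last m) ↔ a ∈ U := by
      intro a
      by_cases ha : a ∈ U
      · simp [M, ha]
      · simp [M, ha, (Fin.castSucc_lt_last _).ne]
    have h2 : ∀ a p, M a = some (Fin.castSucc p) ↔ M' a = some p := by
      intro a p
      by_cases ha : a ∈ U
      · have : M' a = none := by
          cases h : M' a with
          | none => rfl
          | some p => exact absurd ha (Finset.disjoint_left.1 hd (by simp [h]))
        simpa [M, ha, this] using (Fin.castSucc_lt_last p).ne'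
      · simp [M, ha]
    refine ⟨M, fun a p h => ?_, fun p => ?_, ?_, (sum M M' U h1 h2).symm⟩
    · induction p using Fin.lastCases with
      | last => exact hU a ((h1 a).1 h)
      | cast p => exact hE a p ((h2 a p).1 h)
    · induction p using Fin.lastCases with
      | last =>
        have : (Finset.univ.filter fun a => M a = some (Fin.last m)) = U := by ext a; simp [h1]
        rw [this]; exact hQU
      | cast p => simp only [h2]; exact hQ p
    · ext a
      simp only [Finset.mem_filter, Finset.mem_univ, true_and, Finset.mem_union, ← h1,
        Option.isSome_iff_exists, ← h2]
      constructor
      · rintro (⟨p, hp⟩ | hp)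
        exacts [⟨_, hp⟩, ⟨_, hp⟩]
      · rintro ⟨p, hp⟩
        induction p using Fin.lastCases with
        | last => exact .inr hp
        | cast p => exact .inl ⟨p, hp⟩

/-- The table holds the optimal solutions among those in `X`. -/
def Table.Represents (T : Table) (X : Finset (Fin n) → ℚ → Prop) : Prop :=
  (∀ e ∈ T, ∃ S, e.1 = code S ∧ ∀ v, e.2 = some v → 0 < v.2.2 ∧ X S v.toRat) ∧
    ∀ S q, X S q → ∃ v, (code S, some v) ∈ T ∧ 0 < v.2.2 ∧ q ≤ v.toRat

/-- Every candidate arises from a sound entry and an admissible set, hence is attained. Conversely,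
the entry for `S'` is at least as good as the given partial solution, adding the same `U` preserves
this, and the maximum is no smaller than that candidate. -/
theorem Table.Represents.next {T : Table} {X : Finset (Fin n) → ℚ → Prop} (hT : T.Represents X)
    (lo up : ℕ) {w : Fin n → Option RawWeight} (hw : ∀ a x, w a = some x → 0 < x.2) :
    (nextTable (allSets (List.replicate n ())) T (lo, up, List.ofFn w)).Represents
      (Extend X lo up w) := by
  obtain ⟨hT1, hT2⟩ := hT
  set r : Row := (lo, up, List.ofFn w) with hr
  set sets := allSets (List.replicate n ())
  have hsound : ∀ S : Finset (Fin n), ∀ v ∈ T.flatMap fun e => sets.filterMap fun U =>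
      candidate r (code S) e U, 0 < v.2.2 ∧ Extend X lo up w S v.toRat := by
    intro S v hv
    obtain ⟨e, he, hv⟩ := List.mem_flatMap.1 hv
    obtain ⟨U', hU, hv⟩ := List.mem_filterMap.1 hv
    obtain ⟨U, rfl⟩ := (mem_allSets_iff U').1 hU
    obtain ⟨S', hS', hX⟩ := hT1 e he
    unfold candidate at hv
    rw [hS'] at hv
    cases h : isDisjUnion (code S) (code S') (code U) && quotaOK r (code U)
    · rw [h] at hv; cases hv
    · rw [h, cond_true] at hv
      rw [Bool.and_eq_true, isDisjUnion_code, quotaOK_code] at h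
      obtain ⟨x, hx, hv⟩ := Option.bind_eq_some_iff.1 hv
      obtain ⟨v', hv', rfl⟩ := Option.map_eq_some_iff.1 hv
      obtain ⟨h1, h2⟩ := hX v' hv'
      obtain ⟨h3, h4⟩ := rowWeight_code w hw U
      obtain ⟨h5, h6⟩ := h4 x hx
      obtain ⟨h7, h8⟩ := toRat_addFrac h1 h5
      exact ⟨h7, S', U, _, h2, h.1.1, h.1.2, h3.1 ⟨x, hx⟩, h.2, by rw [h8, h6]⟩
  refine ⟨fun e he => ?_, ?_⟩
  · obtain ⟨S'', hS'', rfl⟩ := List.mem_map.1 he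
    obtain ⟨S, rfl⟩ := (mem_allSets_iff S'').1 hS''
    exact ⟨S, rfl, fun v hv => hsound S v (mem_of_maxFrac hv)⟩
  · rintro S q ⟨S', U, q', hX, hd, hS, hE, hQ, rfl⟩
    obtain ⟨v, hv, hpos, hle⟩ := hT2 S' q' hX
    obtain ⟨h3, h4⟩ := rowWeight_code w hw U
    obtain ⟨x, hx⟩ := h3.2 hE
    obtain ⟨h5, h6⟩ := h4 x hx
    obtain ⟨h7, h8⟩ := toRat_addFrac hpos h5
    have hc : candidate r (code S) (code S', some v) (code U) = some (addFrac v x) := by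
      unfold candidate
      rw [(isDisjUnion_code S S' U).2 ⟨hd, hS⟩, (quotaOK_code lo up _ U).2 hQ, hr, hx]
      rfl
    have hmem : addFrac v x ∈ T.flatMap fun e => sets.filterMap fun U =>
        candidate r (code S) e U :=
      List.mem_flatMap.2 ⟨_, hv, List.mem_filterMap.2 ⟨_, (mem_allSets_iff _).2 ⟨U, rfl⟩, hc⟩⟩
    obtain ⟨y, hy, hle'⟩ := exists_maxFrac (fun v hv => (hsound S v hv).1) hmem
    refine ⟨y, List.mem_map.2 ⟨code S, (mem_allSets_iff _).2 ⟨S, rfl⟩, by rw [hy]⟩,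
      (hsound S y (mem_of_maxFrac hy)).1, le_trans ?_ hle'⟩
    rw [h8, h6]
    linarith

/-- Induction on the number of projects, splitting off the last one because the fold treats it last.
-/
theorem represents_finalTable (lo up : Fin m → ℕ) {w : Fin m → Fin n → Option RawWeight}
    (hw : ∀ p a x, w p a = some x → 0 < x.2) :
    (finalTable (allSets (List.replicate n ()))
      (List.ofFn fun p => (lo p, up p, List.ofFn (w p)))).Represents (Feasible lo up w) := by
  induction m with
  | zero =>
    have hempty : (code (∅ : Finset (Fin n))).all (fun b => !b) = true := by
      simp [code]
    have hfe : ∀ (S : Finset (Fin n)) q, Feasible lo up w S q ↔ S = ∅ ∧ q = 0 := by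
      intro S q
      constructor
      · rintro ⟨M, -, -, rfl, rfl⟩
        have : M = fun _ => none := funext fun a => by
          cases h : M a with
          | none => rfl
          | some p => exact p.elim0
        subst this
        simp
      · rintro ⟨rfl, rfl⟩
        exact ⟨fun _ => none, by simp, fun p => p.elim0, by simp, by simp⟩
    refine ⟨fun e he => ?_, fun S q h => ?_⟩
    · obtain ⟨S'', hS'', rfl⟩ := List.mem_map.1 he
      obtain ⟨S, rfl⟩ := (mem_allSets_iff S'').1 hS''
      refine ⟨S, rfl, fun v hv => ?_⟩
      dsimp only at hv
      cases h : (code S).all fun b => !b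
      · rw [h] at hv; cases hv
      · rw [h] at hv
        cases hv
        rw [hfe]
        refine ⟨one_pos, ?_, by simp [Frac.toRat]⟩
        simpa [code, Finset.eq_empty_iff_forall_notMem] using h
    · obtain ⟨rfl, rfl⟩ := (hfe S q).1 h
      exact ⟨(0, 0, 1), List.mem_map.2 ⟨code ∅, (mem_allSets_iff _).2 ⟨∅, rfl⟩, by rw [hempty]; rfl⟩,
        one_pos, by simp [Frac.toRat]⟩
  | succ m ih =>
    have := (ih (fun p => lo p.castSucc) (fun p => up p.castSucc)
      (w := fun p => w p.castSucc) fun p => hw p.castSucc).next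
      (lo (Fin.last m)) (up (Fin.last m)) (hw (Fin.last m))
    rw [List.ofFn_succ', List.concat_eq_append, finalTable, List.foldl_append]
    have e : Feasible lo up w = _ := funext fun S => funext fun q =>
      propext (feasible_succ lo up w S q)
    rw [e]
    exact this

theorem solve_iff (lo up : Fin m → ℕ) {w : Fin m → Fin n → Option RawWeight}
    (hw : ∀ p a x, w p a = some x → 0 < x.2) (b : RawWeight) (hb : 0 < b.2) :
    solve (List.replicate n (), List.ofFn fun p => (lo p, up p, List.ofFn (w p)), b) = true ↔
      ∃ S q, Feasible lo up w S q ∧ b.toRat ≤ q := by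
  have hb' : 0 < (toFrac b).2.2 := by
    unfold toFrac
    cases b.1.1 <;> simpa using hb
  obtain ⟨h1, h2⟩ := represents_finalTable lo up hw
  rw [solve, List.any_eq_true]
  constructor
  · rintro ⟨⟨S', o⟩, he, hv⟩
    obtain ⟨S, -, hS⟩ := h1 _ he
    cases o with
    | none => cases hv
    | some v =>
      obtain ⟨h3, h4⟩ := hS v rfl
      exact ⟨S, _, h4, (leFrac_iff hb' h3).1 hv⟩
  · rintro ⟨S, q, hX, hq⟩
    obtain ⟨v, hv, h3, h4⟩ := h2 S q hX
    exact ⟨_, hv, (leFrac_iff hb' h3).2 (hq.trans h4)⟩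

/-! ### From polynomial-time reductions to fixed-parameter tractability -/

/-- `raw` views the instance as typed data with the same encoding. The reduction preserves the
parameter exactly, so the total time is at most `C * (2 ^ κ I * |I|) ^ k`, which splits into a
function of the parameter and a power of the size. -/
theorem fixedParameterTractable_of_reduction {ι : Type} {encI : ι → Data} {κ : ι → ℕ}
    {yes : ι → Prop} (raw : ι → β) (henc : ∀ I, enc (raw I) = encI I)
    {red : β → List Unit × List Row × RawWeight} (hred : PT red)
    (hκ : ∀ I, (red (raw I)).1.length = κ I) (hyes : ∀ I, solve (red (raw I)) = true ↔ yes I) :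
    FixedParameterTractable encI κ yes := by
  obtain ⟨P, p, hp, hP⟩ := hred
  obtain ⟨Q, q, hq, hQ⟩ := ptn_solve
  -- To be evaluated at `2 ^ κ I * |I|`, which exceeds both `2 ^ κ I` and `|I|`; the `15` pays for
  -- the surrounding assignments.
  have hr : IsPoly fun n => p n + q (n * p n) + 15 :=
    (hp.add (hq.comp (IsPoly.id.mul hp))).add (.const 15)
  obtain ⟨C, k, hC⟩ := hr.le_pow
  let v : Expr := .var 0
  refine ⟨.seq (.seq (.assign 0 (.cons v .nil)) (.seq P Q)) (.assign 0 (.hd v)),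
    fun n => C * (2 ^ n) ^ k, k, ?_, fun I => ?_⟩
  · have hpow : Primrec fun x : ℕ × ℕ => x.1 ^ x.2 := Primrec₂.unpaired'.1 Nat.Primrec.pow
    have h2 : Primrec fun n : ℕ => 2 ^ n := hpow.comp ((Primrec.const 2).pair .id)
    exact (Primrec.nat_mul.comp (Primrec.const C)
      (hpow.comp (h2.pair (Primrec.const k)))).to_comp
  · obtain ⟨hs, hP⟩ := hP (raw I)
    obtain ⟨t, ht, h⟩ := hP .nil
    obtain ⟨t', ht', h'⟩ := (hQ (red (raw I))).2 .nil
    dsimp only at ht'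
    rw [hκ I] at ht'
    have hsize : (encI I).size = esize (raw I) := by rw [esize, henc]
    have h1 : esize (raw I) ≤ 2 ^ κ I * esize (raw I) :=
      Nat.le_mul_of_pos_left _ (Nat.pow_pos two_pos)
    have h2 : 2 ^ κ I ≤ 2 ^ κ I * esize (raw I) := Nat.le_mul_of_pos_right _ (esize_pos _)
    have h3 := hp.mono h1
    have h4 := hq.mono (Nat.mul_le_mul h2 (hs.trans h3))
    have h5 := hC _ ((esize_pos _).trans h1)
    have hrun := ((RunsTo.assign (e := .cons v .nil) (d := encI I)
      (d' := .cons (enc (raw I)) .nil) fun s hs => by simp [v, Expr.eval, hs, henc]).seq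
      (h.seq h')).seq (RunsTo.assign (e := .hd v) (d' := enc (solve (red (raw I))))
        fun s hs => by simp [v, Expr.eval, hs, Data.hd])
    refine ⟨_, _, hrun (initStore (encI I)) rfl, ?_, ?_⟩
    · rw [hsize, mul_assoc, ← mul_pow]
      refine le_trans ?_ h5
      simp only [Expr.time, v]
      omega
    · rw [← hyes I, Function.update_self]
      cases solve (red (raw I)) <;> simp [enc_true, enc_false]

/-! ### The weighted problem -/

/-- The feasible solutions are the matchings. -/
theorem exists_feasible_iff (G : QuotaGraph) (w : Fin G.m → Fin G.n → Option RawWeight) (b : ℚ) :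
    (∃ S q, Feasible G.lower G.upper w S q ∧ b ≤ q) ↔ ∃ M : G.Assignment,
      (∀ a p, M a = some p → (w p a).isSome) ∧ (∀ p, (G.assigned M p).card = 0 ∨
        (G.lower p ≤ (G.assigned M p).card ∧ (G.assigned M p).card ≤ G.upper p)) ∧
      b ≤ ∑ a, (M a).elim 0 fun p => (w p a).elim 0 RawWeight.toRat := by
  constructor
  · rintro ⟨S, q, ⟨M, h1, h2, -, rfl⟩, hb⟩
    exact ⟨M, h1, h2, hb⟩
  · rintro ⟨M, h1, h2, hb⟩
    exact ⟨_, _, ⟨M, h1, h2, rfl, rfl⟩, hb⟩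

/-- Sign, absolute value of the numerator, denominator. -/
def rawWeight (q : ℚ) : RawWeight := ((decide (q.num < 0), q.num.natAbs), q.den)

theorem toRat_rawWeight (q : ℚ) : (rawWeight q).toRat = q := by
  rw [RawWeight.toRat, toFrac, rawWeight]
  conv_rhs => rw [← Rat.num_div_den q]
  by_cases h : q.num < 0
  · have : ((q.num.natAbs : ℤ) : ℚ) = ((-q.num : ℤ) : ℚ) := by congr 1; omega
    push_cast at this
    simp [h, Frac.toRat, this]
  · have : ((q.num.natAbs : ℤ) : ℚ) = ((q.num : ℤ) : ℚ) := by congr 1; omega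
    push_cast at this
    simp [h, Frac.toRat, this]

namespace WeightedInstance

variable (I : WeightedInstance)

/-- The weighted adjacency matrix. -/
def rawEntry (p : Fin I.m) (a : Fin I.n) : Option RawWeight :=
  if h : (a, p) ∈ I.E then some (rawWeight (I.w ⟨(a, p), h⟩)) else none

def raw : List Unit × List Row × RawWeight :=
  (List.replicate I.n (), List.ofFn fun p => (I.lower p, I.upper p, List.ofFn (I.rawEntry p)),
    rawWeight I.bound)

theorem enc_raw : enc I.raw = I.encode := by
  have e : ∀ p, enc (List.ofFn (I.rawEntry p)) = .ofList (List.ofFn fun a =>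
      .ofOption (if h : (a, p) ∈ I.E then some (.ofRat (I.w ⟨(a, p), h⟩)) else none)) := by
    intro p
    change Data.ofList (List.map enc _) = _
    rw [List.map_ofFn]
    congr 2
    funext a
    rw [Function.comp, rawEntry]
    split <;> rfl
  rw [raw, encode, enc_prod, enc_prod]
  congr 2
  · change Data.ofList (List.map enc _) = _
    rw [List.map_replicate]
    rfl
  · change Data.ofList (List.map enc _) = _
    rw [List.map_ofFn]
    congr 2
    funext p
    rw [Function.comp, enc_prod, enc_prod, e]
    rfl

/-- An assignment uses at most one edge per applicant, so the sum over edges collapses to a sum over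
applicants. -/
theorem weight_eq (M : I.Assignment) : I.weight M =
    ∑ a, (M a).elim 0 fun p => (I.rawEntry p a).elim 0 RawWeight.toRat := by
  set g : Fin I.n × Fin I.m → ℚ := fun x =>
    if M x.1 = some x.2 then (I.rawEntry x.2 x.1).elim 0 RawWeight.toRat else 0 with hg
  have h1 : I.weight M = ∑ e : {e : Fin I.n × Fin I.m // e ∈ I.E}, g e := by
    refine Finset.sum_congr rfl fun e _ => ?_
    simp [hg, rawEntry, e.2, toRat_rawWeight]
  rw [h1, Finset.sum_coe_sort I.E g, Finset.sum_subset (Finset.subset_univ _) fun x _ hx => by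
    simp [hg, rawEntry, hx], Fintype.sum_prod_type]
  refine Finset.sum_congr rfl fun a _ => ?_
  cases h : M a with
  | none => simp [hg, h]
  | some p => rw [Fintype.sum_eq_single p fun q hq => by simp [hg, h, hq.symm]]; simp [hg, h]

theorem solve_raw : solve I.raw = true ↔ I.IsYes := by
  rw [raw, solve_iff I.lower I.upper (w := I.rawEntry) ?_ _ I.bound.den_pos,
    exists_feasible_iff I.toQuotaGraph, toRat_rawWeight]
  · refine exists_congr fun M => ?_
    rw [QuotaGraph.IsMatching, weight_eq, and_assoc]
    refine and_congr_left' (forall_congr' fun a => forall_congr' fun p => imp_congr_right fun _ => ?_)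
    rw [rawEntry]
    split <;> simp [*]
  · intro p a x hx
    rw [rawEntry] at hx
    split at hx
    · cases hx; exact Rat.den_pos _
    · cases hx

theorem fixedParameterTractable :
    FixedParameterTractable encode (fun I => I.n) IsYes :=
  fixedParameterTractable_of_reduction raw enc_raw PT.id (fun I => by simp [raw]) solve_raw

end WeightedInstance

/-! ### Ranks in preference lists -/

section Lists

variable {σ : Type*} [DecidableEq σ]

/-- Absence of repetitions is essential: otherwise `p` could precede only a second copy of `q`. -/
theorem pair_sublist_iff_idxOf_lt {l : List σ} (hl : l.Nodup) {p q : σ} (hq : q ∈ l) :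
    [p, q].Sublist l ↔ l.idxOf p < l.idxOf q := by
  induction l with
  | nil => simp at hq
  | cons x l ih =>
    rw [List.nodup_cons] at hl
    rw [List.idxOf_cons, List.idxOf_cons]
    by_cases hqx : x = q
    · subst hqx
      have h : ¬ [p, x].Sublist (x :: l) := fun h => by
        rcases List.cons_sublist_cons'.1 h with h | ⟨-, h⟩
        · exact hl.1 (h.subset (by simp))
        · exact hl.1 (h.subset (by simp))
      simp [h]
    · have hql : q ∈ l := (List.mem_cons.1 hq).resolve_left (Ne.symm hqx)
      have hqx' : (x == q) = false := by simpa using hqx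
      rw [hqx', cond_false, List.cons_sublist_cons', ih hl.2 hql, List.singleton_sublist]
      by_cases hpx : x = p
      · simp [hpx, hql]
      · have hpx' : (x == p) = false := by simpa using hpx
        simp [hpx', Ne.symm hpx]

/-- Does `k` occur in the list `l`, and before `o` if this is an element of `l`? -/
def isBefore (k : σ) (o : Option σ) (l : List σ) : Bool :=
  (l.foldl (fun q x => (q.1 || o.elim false fun y => decide (x = y),
    q.2 || (!q.1 && (!(o.elim false fun y => decide (x = y)) && decide (x = k))))) (false, false)).2

/-- In the fold, `s` records that `y` has been met and `f` that `k` was met before it. Absent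
elements are covered, since `idxOf` gives them the length of the list. -/
theorem isBefore_some (k y : σ) (l : List σ) :
    isBefore k (some y) l = true ↔ l.idxOf k < l.idxOf y := by
  have key : ∀ (l : List σ) (s f : Bool), (l.foldl (fun (q : Bool × Bool) x =>
      (q.1 || decide (x = y), q.2 || (!q.1 && (!decide (x = y) && decide (x = k)))))
      (s, f)).2 = (f || (!s && decide (l.idxOf k < l.idxOf y))) := by
    intro l
    induction l with
    | nil => simp
    | cons x l ih =>
      intro s f
      rw [List.foldl_cons, ih, List.idxOf_cons, List.idxOf_cons]
      by_cases h : x = y <;> by_cases h' : x = k <;> cases s <;> cases f <;> simp [h, h']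
      all_goals simp_all [beq_eq_decide]
  have := key l false false
  simp only [Bool.false_or, Bool.not_false, Bool.true_and] at this
  rw [isBefore]
  simp only [Option.elim_some]
  rw [this, decide_eq_true_iff]

theorem isBefore_none (k : σ) (l : List σ) :
    isBefore k none l = true ↔ l.idxOf k < l.length := by
  have key : ∀ (l : List σ) (f : Bool), (l.foldl (fun (q : Bool × Bool) x =>
      (q.1 || false, q.2 || (!q.1 && (!false && decide (x = k)))))
      (false, f)).2 = (f || decide (k ∈ l)) := by
    intro l
    induction l with
    | nil => simp
    | cons x l ih =>
      intro f
      rw [List.foldl_cons, Bool.or_false, ih]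
      by_cases h : x = k
      · cases f <;> simp [h]
      · cases f <;> simp [h, Ne.symm h]
  rw [isBefore]
  simp only [Option.elim_none]
  rw [key, List.idxOf_lt_length_iff]
  simp

theorem idxOf_map {τ : Type*} [DecidableEq τ] {f : σ → τ} (hf : f.Injective) (l : List σ) (k : σ) :
    (l.map f).idxOf (f k) = l.idxOf k := by
  induction l with
  | nil => simp
  | cons x l ih =>
    rw [List.map_cons, List.idxOf_cons, List.idxOf_cons, ih]
    have : (f x == f k) = (x == k) := by rw [Bool.eq_iff_iff]; simp [hf.eq_iff]
    rw [this]

theorem isBefore_map {τ : Type*} [DecidableEq τ] {f : σ → τ} (hf : f.Injective) (k : σ)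
    (o : Option σ) (l : List σ) : isBefore (f k) (o.map f) (l.map f) = isBefore k o l := by
  rw [Bool.eq_iff_iff]
  cases o with
  | none => rw [Option.map_none, isBefore_none, isBefore_none, idxOf_map hf, List.length_map]
  | some y => rw [Option.map_some, isBefore_some, isBefore_some, idxOf_map hf, idxOf_map hf]

end Lists

/-! ### Reductions to the weighted problem -/

/-- A natural number as a weight. -/
def natWeight (k : ℕ) : RawWeight := ((false, k), 1)

/-- The weight of the edge between the applicant with preference list `l` and the project `k`, when
`o` is the applicant's project in the given matching. If `keep` is false, there is no edge if the
applicant prefers `o`. -/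
def voteWeight (keep : Bool) (c k : ℕ) (o : Option ℕ) (l : List ℕ) : Option RawWeight :=
  bif isBefore k o l then some (natWeight ((o.elim 0 fun _ => c) + 1))
  else bif o.elim false fun y => decide (y = k) then some (natWeight c)
  else bif keep && l.any fun x => decide (x = k) then some (natWeight 0) else none

def voteRows (keep : Bool) (c : ℕ) (quotas : List (ℕ × ℕ)) (applicants : List (List ℕ × Option ℕ)) :
    List Row :=
  quotas.zipIdx.map fun q =>
    (q.1.1, q.1.2, applicants.map fun a => voteWeight keep c q.2 a.2 a.1)

/-- The reduction of the verification problems, with the weight of keeping a given assignment. -/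
def verifyReduction (keep : Bool) (c : ℕ) (I : (List (ℕ × ℕ) × List (List ℕ)) × List (Option ℕ)) :
    List Unit × List Row × RawWeight :=
  (I.1.2.map fun _ => (), voteRows keep c I.1.1 (I.1.2.zip I.2),
    natWeight (c * (I.2.filterMap fun o => o).length + 1))

/-- The reduction of the search for a matching of all applicants. -/
def perfectReduction (I : List (ℕ × ℕ) × List (List ℕ)) : List Unit × List Row × RawWeight :=
  (I.2.map fun _ => (), voteRows true 1 I.1 (I.2.map fun l => (l, none)), natWeight I.2.length)

namespace PT

@[fun_prop]
theorem zipIdx {l : α → List β} (hl : PT l) : PT fun x => (l x).zipIdx := by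
  have key : ∀ l : List β, l.foldl (fun acc a => (a, acc.length) :: acc) [] = l.zipIdx.reverse := by
    intro l
    induction l using List.reverseRecOn with
    | nil => rfl
    | append_singleton l a ih =>
      rw [List.foldl_append, ih, List.zipIdx_append]
      simp
  refine comp (g := fun l : List β => l.zipIdx) ?_ hl
  refine congr (f := fun l : List β =>
    (l.foldl (fun acc a => (a, acc.length) :: acc) []).reverse) ?_ fun l => ?_
  · have hp : IsPoly fun n => n * (n + (4 * n + 1) + 1 + 1) + 1 :=
      (IsPoly.id.mul (((IsPoly.id.add (((IsPoly.const 4).mul .id).add (.const 1))).add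
        (.const 1)).add (.const 1))).add (.const 1)
    refine reverse (foldl id (const _) (by fun_prop) hp fun l s hs => ?_)
    have hlen := hs.length_le.trans (length_le_esize l)
    rw [key, esize_reverse]
    refine esize_list_le (by rwa [List.length_zipIdx]) fun q hq => ?_
    have h1 := List.mem_zipIdx' hq
    have h2 : esize q.1 ≤ esize l :=
      esize_le_of_mem (hs.subset (by rw [h1.2]; exact List.getElem_mem _))
    have h3 := esize_nat_le (k := q.2) (m := esize l)
      (h1.1.trans_le (hlen.trans Nat.lt_two_pow_self.le))
    rw [esize_prod]
    omega
  · rw [key, List.reverse_reverse]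

@[fun_prop]
theorem isBefore {k : α → ℕ} {o : α → Option ℕ} {l : α → List ℕ} (hk : PT k) (ho : PT o)
    (hl : PT l) : PT fun x => isBefore (k x) (o x) (l x) := by
  refine comp (g := fun q : ℕ × Option ℕ × List ℕ => HouseAllocation.isBefore q.1 q.2.1 q.2.2) ?_
    (hk.prodMk (ho.prodMk hl))
  unfold HouseAllocation.isBefore
  refine snd.comp (foldl_of_bounded (by fun_prop) (const _) (by fun_prop) 7 fun b => ?_)
  have := esize_bool_le b.1
  have := esize_bool_le b.2
  rw [esize_prod]; omega

@[fun_prop]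
theorem natWeight {k : α → ℕ} (hk : PT k) : PT fun x => natWeight (k x) := by
  unfold HouseAllocation.natWeight; fun_prop

@[fun_prop]
theorem voteWeight {keep : α → Bool} {c k : α → ℕ} {o : α → Option ℕ} {l : α → List ℕ}
    (hkeep : PT keep) (hc : PT c) (hk : PT k) (ho : PT o) (hl : PT l) :
    PT fun x => voteWeight (keep x) (c x) (k x) (o x) (l x) := by
  unfold HouseAllocation.voteWeight; fun_prop

@[fun_prop]
theorem voteRows {keep : α → Bool} {c : α → ℕ} {q : α → List (ℕ × ℕ)}
    {a : α → List (List ℕ × Option ℕ)} (hkeep : PT keep) (hc : PT c) (hq : PT q) (ha : PT a) :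
    PT fun x => voteRows (keep x) (c x) (q x) (a x) := by
  unfold HouseAllocation.voteRows; fun_prop

@[fun_prop]
theorem verifyReduction {keep : α → Bool} {c : α → ℕ}
    {I : α → (List (ℕ × ℕ) × List (List ℕ)) × List (Option ℕ)} (hkeep : PT keep) (hc : PT c)
    (hI : PT I) : PT fun x => verifyReduction (keep x) (c x) (I x) := by
  unfold HouseAllocation.verifyReduction; fun_prop

theorem perfectReduction : PT perfectReduction := by
  unfold HouseAllocation.perfectReduction; fun_prop

end PT

namespace PrefInstance

variable (I : PrefInstance)

/-! ### Correctness of the reductions -/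

/-- The position of an outcome in the order of an applicant. -/
def rank (a : Fin I.n) (x : Option (Fin I.m)) : ℕ :=
  x.elim (I.pref a).length fun p => (I.pref a).idxOf p

variable {I}

/-- Acceptability matters: a project off the list has the rank of being unmatched, yet no project on
the list is preferred to it in the sense of `Prefers`. -/
theorem prefers_iff {a : Fin I.n} {x y : Option (Fin I.m)} (hx : ∀ p, x = some p → p ∈ I.pref a)
    (hy : ∀ p, y = some p → p ∈ I.pref a) : I.Prefers a x y ↔ I.rank a x < I.rank a y := by
  cases x with
  | none =>
    simp only [Prefers, rank, Option.elim_none, false_iff, not_lt]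
    cases y with
    | none => rfl
    | some q => exact List.idxOf_le_length
  | some p =>
    cases y with
    | none => simp [Prefers, rank, List.idxOf_lt_length_iff]
    | some q => exact pair_sublist_iff_idxOf_lt (I.nodup_pref a) (hy q rfl)

theorem eq_of_rank_eq {a : Fin I.n} {x y : Option (Fin I.m)} (hx : ∀ p, x = some p → p ∈ I.pref a)
    (hy : ∀ p, y = some p → p ∈ I.pref a) (h : I.rank a x = I.rank a y) : x = y := by
  have key : ∀ p, p ∈ I.pref a → (I.pref a).idxOf p ≠ (I.pref a).length := fun p hp =>
    (List.idxOf_lt_length_iff.2 hp).ne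
  cases x with
  | none =>
    cases y with
    | none => rfl
    | some q => exact absurd h.symm (key q (hy q rfl))
  | some p =>
    cases y with
    | none => exact absurd h (key p (hx p rfl))
    | some q => rw [List.idxOf_inj (hx p rfl) |>.1 h]

variable (I) in
/-- The weights used by the reductions, for a given assignment `M`. -/
def weightOf (M : I.Assignment) (keep : Bool) (c : ℕ) (p : Fin I.m) (a : Fin I.n) :
    Option RawWeight :=
  voteWeight keep c p ((M a).map Fin.val) ((I.pref a).map Fin.val)

theorem weightOf_eq (M : I.Assignment) (keep : Bool) (c : ℕ) (p : Fin I.m) (a : Fin I.n) :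
    I.weightOf M keep c p a = if I.rank a (some p) < I.rank a (M a) then
        some (natWeight ((if M a = none then 0 else c) + 1))
      else if M a = some p then some (natWeight c)
      else if keep = true ∧ p ∈ I.pref a then some (natWeight 0) else none := by
  have h1 : isBefore (p : ℕ) ((M a).map Fin.val) ((I.pref a).map Fin.val) =
      decide (I.rank a (some p) < I.rank a (M a)) := by
    rw [isBefore_map Fin.val_injective, Bool.eq_iff_iff, decide_eq_true_iff]
    cases h : M a with
    | none => exact isBefore_none _ _
    | some q => exact isBefore_some _ _ _
  have h2 : (((M a).map Fin.val).elim false fun y => decide (y = (p : ℕ))) =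
      decide (M a = some p) := by
    cases M a <;> simp [Fin.ext_iff]
  have h3 : (((I.pref a).map Fin.val).any fun x => decide (x = (p : ℕ))) =
      decide (p ∈ I.pref a) := by
    rw [Bool.eq_iff_iff]
    simp [← Fin.ext_iff]
  have h4 : (((M a).map Fin.val).elim 0 fun _ => c) = if M a = none then 0 else c := by
    cases M a <;> simp
  rw [weightOf, voteWeight, h1, h2, h3, h4]
  simp [Bool.cond_eq_ite]

theorem toRat_natWeight (k : ℕ) : (natWeight k).toRat = k := by
  simp [RawWeight.toRat, toFrac, natWeight, Frac.toRat]

theorem pos_of_weightOf (M : I.Assignment) (keep : Bool) (c : ℕ) (p : Fin I.m) (a : Fin I.n)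
    (x : RawWeight) (hx : I.weightOf M keep c p a = some x) : 0 < x.2 := by
  rw [weightOf_eq] at hx
  split_ifs at hx <;> · cases hx; exact one_pos

theorem isSome_weightOf {M : I.Assignment} (hM : ∀ a p, M a = some p → p ∈ I.pref a) {keep : Bool}
    {c : ℕ} {p : Fin I.m} {a : Fin I.n} : (I.weightOf M keep c p a).isSome ↔ p ∈ I.pref a ∧
      (keep = true ∨ ¬ I.rank a (M a) < I.rank a (some p)) := by
  rw [weightOf_eq]
  have hle : I.rank a (M a) ≤ (I.pref a).length := by
    rw [rank]
    cases M a
    exacts [le_rfl, List.idxOf_le_length]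
  by_cases h1 : I.rank a (some p) < I.rank a (M a)
  · have : p ∈ I.pref a := List.idxOf_lt_length_iff.1 (h1.trans_le hle)
    simp [h1, this, h1.le]
  by_cases h2 : M a = some p
  · simp [h2, hM a p h2]
  rw [if_neg h1, if_neg h2]
  by_cases hp : p ∈ I.pref a
  · have : I.rank a (M a) < I.rank a (some p) := by
      refine lt_of_le_of_ne (not_lt.1 h1) fun h => h2 (eq_of_rank_eq (hM a) ?_ h)
      rintro _ ⟨⟩
      exact hp
    cases keep <;> simp [hp, this]
  · simp [hp]

/-- The contribution of one applicant, checked in each case of better, equal and worse. Becoming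
unmatched counts as worse: it forfeits the weight `c` even when the edges to worse projects are
absent. -/
theorem elim_weightOf {M M' : I.Assignment} {keep : Bool} {c : ℕ}
    (hM : ∀ a p, M a = some p → p ∈ I.pref a)
    (h : ∀ a p, M' a = some p → (I.weightOf M keep c p a).isSome) (a : Fin I.n) :
    ((M' a).elim 0 fun p => (I.weightOf M keep c p a).elim 0 RawWeight.toRat) +
        c * (if I.rank a (M a) < I.rank a (M' a) then 1 else 0) =
      c * (if M a = none then 0 else 1) + if I.rank a (M' a) < I.rank a (M a) then 1 else 0 := by
  cases hp : M' a with
  | none =>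
    cases hq : M a with
    | none => simp
    | some q =>
      have : I.rank a (some q) < I.rank a none := List.idxOf_lt_length_iff.2 (hM a q hq)
      simp [this, this.le]
  | some p =>
    have hs := (isSome_weightOf hM).1 (h a p hp)
    rw [Option.elim_some, weightOf_eq]
    by_cases h1 : I.rank a (some p) < I.rank a (M a)
    · rw [if_pos h1, if_neg h1.le.not_gt, if_pos h1]
      by_cases h2 : M a = none <;> simp [h2, toRat_natWeight]
    rw [if_neg h1, if_neg h1]
    by_cases h2 : M a = some p
    · simp [h2, toRat_natWeight]
    have h3 : I.rank a (M a) < I.rank a (some p) := by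
      refine lt_of_le_of_ne (not_lt.1 h1) fun h => h2 (eq_of_rank_eq (hM a) ?_ h)
      rintro _ ⟨⟩
      exact hs.1
    have h4 : M a ≠ none := by
      intro h4
      rw [h4] at h3
      exact absurd h3 (not_lt.2 List.idxOf_le_length)
    simp [h2, h3, h4, hs.1, hs.2.resolve_right (not_not.2 h3), toRat_natWeight]

end PrefInstance

theorem voteRows_ofFn {n m : ℕ} (keep : Bool) (c : ℕ) (q : Fin m → ℕ × ℕ)
    (x : Fin n → List ℕ × Option ℕ) : voteRows keep c (List.ofFn q) (List.ofFn x) =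
      List.ofFn fun p : Fin m => ((q p).1, (q p).2,
        List.ofFn fun a => voteWeight keep c p (x a).2 (x a).1) := by
  refine List.ext_getElem (by simp [voteRows]) fun i h h' => ?_
  simp [voteRows, List.map_ofFn, Function.comp_def]

/-! ### From weights to numbers of votes; matchings of all applicants -/

namespace PrefInstance

variable {I : PrefInstance}

theorem card_rank {M M' : I.Assignment} (hM : ∀ a p, M a = some p → p ∈ I.pref a)
    (hM' : ∀ a p, M' a = some p → p ∈ I.pref a) :
    {a | I.Prefers a (M a) (M' a)}.ncard =
      (Finset.univ.filter fun a => I.rank a (M a) < I.rank a (M' a)).card := by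
  rw [← Set.ncard_coe_finset]
  congr 1
  ext a
  simp [prefers_iff (hM a) (hM' a)]

/-- Summing `elim_weightOf` over the applicants turns the weight condition into a comparison of the
numbers of better and worse off applicants. -/
theorem solve_weightOf {M : I.Assignment} (hM : ∀ a p, M a = some p → p ∈ I.pref a) (keep : Bool)
    (c k : ℕ) : solve (List.replicate I.n (), List.ofFn fun p => (I.lower p, I.upper p,
        List.ofFn (I.weightOf M keep c p)), natWeight k) = true ↔
      ∃ M' : I.Assignment, I.IsMatching M' ∧
        (keep = true ∨ ∀ a p, M' a = some p → ¬ I.rank a (M a) < I.rank a (some p)) ∧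
        k + c * (Finset.univ.filter fun a => I.rank a (M a) < I.rank a (M' a)).card ≤
          c * (Finset.univ.filter fun a => M a ≠ none).card +
            (Finset.univ.filter fun a => I.rank a (M' a) < I.rank a (M a)).card := by
  rw [solve_iff I.lower I.upper (w := I.weightOf M keep c) (pos_of_weightOf M keep c) _ one_pos,
    exists_feasible_iff I.toQuotaGraph, toRat_natWeight]
  refine exists_congr fun M' => ?_
  have h1 : (∀ a p, M' a = some p → (I.weightOf M keep c p a).isSome) ↔
      (∀ a p, M' a = some p → (a, p) ∈ I.E) ∧
        (keep = true ∨ ∀ a p, M' a = some p → ¬ I.rank a (M a) < I.rank a (some p)) := by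
    simp only [isSome_weightOf hM, I.mem_pref]
    cases keep
    · simp only [Bool.false_eq_true, false_or]
      exact ⟨fun h => ⟨fun a p hp => (h a p hp).1, fun a p hp => (h a p hp).2⟩,
        fun h a p hp => ⟨h.1 a p hp, h.2 a p hp⟩⟩
    · simp
  rw [h1, QuotaGraph.IsMatching, and_assoc, and_assoc]
  refine and_congr_right fun hE => ?_
  rw [and_left_comm]
  refine and_congr_right fun hQ => and_congr_right fun hkeep => ?_
  have h2 := Finset.sum_congr (rfl : (Finset.univ : Finset (Fin I.n)) = _) fun a _ =>
    elim_weightOf hM (h1.2 ⟨hE, hkeep⟩) a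
  rw [Finset.sum_add_distrib, Finset.sum_add_distrib, ← Finset.mul_sum, ← Finset.mul_sum,
    Finset.sum_boole, Finset.sum_boole] at h2
  have h3 : ∑ a, (if M a = none then (0 : ℚ) else 1) =
      (Finset.univ.filter fun a => M a ≠ none).card := by
    rw [← Finset.sum_boole]
    exact Finset.sum_congr rfl fun a _ => by split_ifs <;> simp_all
  rw [h3] at h2
  rw [← Nat.cast_le (α := ℚ)]
  push_cast
  rw [← h2]
  constructor <;> intro h <;> linarith

variable (I) in
/-- The instance as data for the reductions. -/
def raw : List (ℕ × ℕ) × List (List ℕ) :=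
  (List.ofFn fun p => (I.lower p, I.upper p), List.ofFn fun a => (I.pref a).map Fin.val)

theorem enc_raw : enc I.raw = I.encode := by
  rw [raw, encode, enc_prod]
  congr 1
  · change Data.ofList (List.map enc _) = _
    rw [List.map_ofFn]
    rfl
  · change Data.ofList (List.map enc _) = _
    rw [List.map_ofFn]
    congr 2
    funext a
    change Data.ofList (List.map enc _) = _
    -- The encoding coerces the list of projects to a list of numbers by a monadic bind, which is
    -- rewritten here as a map.
    rw [List.map_map, bind_pure_comp, List.map_eq_map, List.map_map]
    rfl

/-- Among the matchings of all applicants, one with least total rank is Pareto optimal: a dominating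
matching would again match everybody and have a smaller total rank. -/
theorem hasPerfectParetoOptimal_of_isMatching {M : I.Assignment} (hM : I.IsMatching M)
    (hall : ∀ a, M a ≠ none) : I.HasPerfectParetoOptimal := by
  have hpref : ∀ {M : I.Assignment}, I.IsMatching M → ∀ a p, M a = some p → p ∈ I.pref a :=
    fun hM a p h => (I.mem_pref a p).2 (hM.1 a p h)
  obtain ⟨N, ⟨hN, hN'⟩, hmin⟩ := WellFounded.has_min
    (measure fun M : I.Assignment => ∑ a, I.rank a (M a)).wf
    {M | I.IsMatching M ∧ ∀ a, M a ≠ none} ⟨M, hM, hall⟩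
  refine ⟨N, ⟨hN, ?_⟩, hN'⟩
  rintro ⟨N₂, hN₂, hnot, a, ha⟩
  rw [prefers_iff (hpref hN₂ a) (hpref hN a)] at ha
  push Not at hnot
  have hle : ∀ a, I.rank a (N₂ a) ≤ I.rank a (N a) := fun a => by
    have := hnot a
    rwa [prefers_iff (hpref hN a) (hpref hN₂ a), not_lt] at this
  -- Being unmatched has larger rank than any acceptable project, so `N₂`, in which nobody is worse
  -- off, matches all applicants too.
  refine hmin N₂ ⟨hN₂, fun a h => ?_⟩
    (Finset.sum_lt_sum (fun a _ => hle a) ⟨a, Finset.mem_univ _, ha⟩)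
  obtain ⟨p, hp⟩ := Option.ne_none_iff_exists'.1 (hN' a)
  have h1 := hle a
  rw [h, hp] at h1
  exact absurd h1 (not_le.2 (List.idxOf_lt_length_iff.2 (hpref hN a p hp)))

/-- Relative to the empty assignment every edge is an improvement and weighs `1`, so the bound `n`
asks that all applicants be matched. -/
theorem solve_perfectReduction :
    solve (perfectReduction I.raw) = true ↔ I.HasPerfectParetoOptimal := by
  have e : perfectReduction I.raw = (List.replicate I.n (), List.ofFn fun p => (I.lower p, I.upper p,
      List.ofFn (I.weightOf (fun _ => none) true 1 p)), natWeight I.n) := by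
    rw [perfectReduction, raw, List.map_ofFn, List.map_ofFn, voteRows_ofFn, List.length_ofFn]
    congr 1
    exact List.ofFn_const _ _
  rw [e, solve_weightOf (by simp)]
  have key : ∀ M : I.Assignment, I.IsMatching M → ∀ a,
      I.rank a (M a) < I.rank a none ↔ M a ≠ none := by
    intro M hM a
    cases h : M a with
    | none => simp
    | some p =>
      have : I.rank a (some p) < I.rank a none :=
        List.idxOf_lt_length_iff.2 ((I.mem_pref a p).2 (hM.1 a p h))
      simp [this]
  constructor
  · rintro ⟨M, hM, -, h⟩
    refine hasPerfectParetoOptimal_of_isMatching hM ?_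
    -- As the reference assignment is empty, `h` says that at least `n` applicants, hence all of
    -- them, are matched.
    simp only [key M hM, ne_eq, not_true_eq_false, Finset.filter_false, Finset.card_empty, mul_zero,
      zero_add] at h
    have h' : (Finset.univ.filter fun a => M a ≠ none).card = Fintype.card (Fin I.n) :=
      le_antisymm (Finset.card_le_univ _) (by rw [Fintype.card_fin]; simpa using by omega)
    rw [Finset.card_eq_iff_eq_univ] at h'
    intro a
    have : a ∈ Finset.univ.filter fun a => M a ≠ none := by rw [h']; exact Finset.mem_univ a
    exact (Finset.mem_filter.1 this).2
  · rintro ⟨M, ⟨hM, -⟩, hall⟩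
    refine ⟨M, hM, .inl rfl, ?_⟩
    have h1 : ∀ a, I.rank a (M a) < I.rank a none := fun a => (key M hM a).2 (hall a)
    simp [h1, fun a => (h1 a).le.not_gt]

theorem fixedParameterTractable :
    FixedParameterTractable encode (fun I => I.n) HasPerfectParetoOptimal :=
  fixedParameterTractable_of_reduction raw (fun _ => enc_raw) PT.perfectReduction
    (fun I => by simp [raw, perfectReduction]) fun _ => solve_perfectReduction

end PrefInstance

/-! ### The two verification problems -/

namespace VerificationInstance

variable (I : VerificationInstance)

/-- The instance as data for the reductions. -/
def raw : (List (ℕ × ℕ) × List (List ℕ)) × List (Option ℕ) :=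
  (I.toPrefInstance.raw, List.ofFn fun a => (I.M a).map Fin.val)

theorem enc_raw : enc I.raw = I.encode := by
  rw [raw, encode, enc_prod, PrefInstance.enc_raw]
  congr 1
  change Data.ofList (List.map enc _) = _
  rw [List.map_ofFn]
  congr 2
  funext a
  change Data.ofOption (Option.map enc _) = _
  rw [Option.map_map, bind_pure_comp, Option.map_eq_map, Option.map_map]
  rfl

theorem mem_pref_of_M (a : Fin I.n) (p : Fin I.m) (h : I.M a = some p) : p ∈ I.pref a :=
  (I.mem_pref a p).2 (I.isMatching.1 a p h)

/-- The bound is one more than the weight `c * |M|` of `M` itself; this term cancels and leaves a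
strict inequality between gains and weighted losses. -/
theorem solve_verifyReduction (keep : Bool) (c : ℕ) :
    solve (verifyReduction keep c I.raw) = true ↔ ∃ M' : I.Assignment, I.IsMatching M' ∧
      (keep = true ∨ ∀ a p, M' a = some p → ¬ I.rank a (I.M a) < I.rank a (some p)) ∧
      c * (Finset.univ.filter fun a => I.rank a (I.M a) < I.rank a (M' a)).card <
        (Finset.univ.filter fun a => I.rank a (M' a) < I.rank a (I.M a)).card := by
  have hcard : ((List.ofFn fun a => (I.M a).map Fin.val).filterMap fun o => o).length =
      (Finset.univ.filter fun a => I.M a ≠ none).card := by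
    rw [List.ofFn_eq_map, List.filterMap_map]
    have : (Finset.univ.filter fun a => I.M a ≠ none) =
        ((List.finRange I.n).filter fun a => (I.M a).isSome).toFinset := by
      ext a; simp [Option.isSome_iff_ne_none]
    rw [this, List.toFinset_card_of_nodup ((List.nodup_finRange _).filter _)]
    generalize List.finRange I.n = l
    induction l with
    | nil => rfl
    | cons a l ih => cases h : I.M a <;> simp_all
  have e : verifyReduction keep c I.raw = (List.replicate I.n (), List.ofFn fun p =>
      (I.lower p, I.upper p, List.ofFn (I.weightOf I.M keep c p)),
      natWeight (c * (Finset.univ.filter fun a => I.M a ≠ none).card + 1)) := by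
    have hz : (List.ofFn fun a => (I.pref a).map Fin.val).zip
        (List.ofFn fun a => (I.M a).map Fin.val) =
        List.ofFn fun a => ((I.pref a).map Fin.val, (I.M a).map Fin.val) := by
      rw [List.ofFn_eq_map, List.ofFn_eq_map, List.zip_map', List.ofFn_eq_map]
    rw [verifyReduction, raw, PrefInstance.raw, hz, voteRows_ofFn, hcard, List.map_ofFn]
    congr 1
    exact List.ofFn_const _ _
  rw [e, PrefInstance.solve_weightOf I.mem_pref_of_M]
  refine exists_congr fun M' => and_congr_right fun _ => and_congr_right fun _ => ?_
  omega

theorem solve_popular : solve (verifyReduction true 1 I.raw) = true ↔ I.HasMorePopular := by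
  rw [solve_verifyReduction]
  refine exists_congr fun M' => and_congr_right fun hM' => ?_
  have h : ∀ a p, M' a = some p → p ∈ I.pref a := fun a p h => (I.mem_pref a p).2 (hM'.1 a p h)
  rw [PrefInstance.MorePopular, PrefInstance.card_rank I.mem_pref_of_M h,
    PrefInstance.card_rank h I.mem_pref_of_M]
  simp

/-- Edges to worse projects are deleted, so an applicant can lose only by becoming unmatched; the
factor `n + 1` rules this out. It is computed as the number of preference lists plus one. -/
theorem solve_dominating :
    solve (verifyReduction false (I.raw.1.2.length + 1) I.raw) = true ↔ I.HasDominating := by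
  rw [solve_verifyReduction]
  refine exists_congr fun M' => and_congr_right fun hM' => ?_
  have h : ∀ a p, M' a = some p → p ∈ I.pref a := fun a p h => (I.mem_pref a p).2 (hM'.1 a p h)
  have hn : I.raw.1.2.length = I.n := by simp [raw, PrefInstance.raw]
  have e1 : ∀ a, I.Prefers a (I.M a) (M' a) ↔ I.rank a (I.M a) < I.rank a (M' a) :=
    fun a => PrefInstance.prefers_iff (I.mem_pref_of_M a) (h a)
  have e2 : ∀ a, I.Prefers a (M' a) (I.M a) ↔ I.rank a (M' a) < I.rank a (I.M a) :=
    fun a => PrefInstance.prefers_iff (h a) (I.mem_pref_of_M a)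
  rw [PrefInstance.Dominates]
  simp only [e1, e2, hn, Bool.false_eq_true, false_or]
  have hle := Finset.card_le_univ (Finset.univ.filter fun a => I.rank a (M' a) < I.rank a (I.M a))
  rw [Fintype.card_fin] at hle
  constructor
  · rintro ⟨-, hlt⟩
    have h0 : (Finset.univ.filter fun a => I.rank a (I.M a) < I.rank a (M' a)).card = 0 := by
      -- A single loss would cost `n + 1`, more than the at most `n` possible gains.
      by_contra h0
      have := Nat.le_mul_of_pos_right (I.n + 1) (Nat.pos_of_ne_zero h0)
      omega
    rw [h0, mul_zero, Finset.card_pos] at hlt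
    obtain ⟨a, ha⟩ := hlt
    refine ⟨fun ⟨a, ha⟩ => ?_, a, (Finset.mem_filter.1 ha).2⟩
    have := Finset.card_eq_zero.1 h0
    exact absurd (Finset.mem_filter.2 ⟨Finset.mem_univ a, ha⟩) (by rw [this]; simp)
  · rintro ⟨hnot, a, ha⟩
    push Not at hnot
    refine ⟨fun a p hp => by rw [← hp]; exact not_lt.2 (hnot a), ?_⟩
    rw [Finset.filter_false_of_mem fun a _ => not_lt.2 (hnot a), Finset.card_empty, mul_zero,
      Finset.card_pos]
    exact ⟨a, Finset.mem_filter.2 ⟨Finset.mem_univ a, ha⟩⟩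

theorem fixedParameterTractable_popular :
    FixedParameterTractable encode (fun I => I.n) HasMorePopular :=
  fixedParameterTractable_of_reduction raw enc_raw
    (red := fun x => verifyReduction true 1 x) (by fun_prop)
    (fun I => by simp [raw, PrefInstance.raw, verifyReduction]) solve_popular

theorem fixedParameterTractable_dominating :
    FixedParameterTractable encode (fun I => I.n) HasDominating :=
  fixedParameterTractable_of_reduction raw enc_raw
    (red := fun x => verifyReduction false (x.1.2.length + 1) x) (by fun_prop)
    (fun I => by simp [raw, PrefInstance.raw, verifyReduction]) solve_dominating

end VerificationInstance
end HouseAllocation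

theorem mainTheorem5 :
    HouseAllocation.FixedParameterTractable HouseAllocation.WeightedInstance.encode
      (fun I => I.n) HouseAllocation.WeightedInstance.IsYes ∧
    HouseAllocation.FixedParameterTractable HouseAllocation.VerificationInstance.encode
      (fun I => I.n) HouseAllocation.VerificationInstance.HasMorePopular ∧
    HouseAllocation.FixedParameterTractable HouseAllocation.VerificationInstance.encode
      (fun I => I.n) HouseAllocation.VerificationInstance.HasDominating ∧
    HouseAllocation.FixedParameterTractable HouseAllocation.PrefInstance.encode
      (fun I => I.n) HouseAllocation.PrefInstance.HasPerfectParetoOptimal :=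
  ⟨HouseAllocation.WeightedInstance.fixedParameterTractable,
    HouseAllocation.VerificationInstance.fixedParameterTractable_popular,
    HouseAllocation.VerificationInstance.fixedParameterTractable_dominating,
    HouseAllocation.PrefInstance.fixedParameterTractable⟩
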